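/- Let $\Bbbk$ be a field and let $R=\bigoplus_{i\ge 0}R_i$ be an $\mathbb N$-graded $\Bbbk$-algebra that is left and right noetherian and locally finite ($\dim_\Bbbk R_i<\infty$ for all $i$), with $d:=\operatorname{GKdim}R$ a real number (so $R\neq0$ and $\operatorname{GKdim}R<\infty$). Let $H$ be a finite-dimensional Hopf algebra over $\Bbbk$ that has a left and right integral $\int$ with $\varepsilon(\int)=1$ (equivalently, $H$ is semisimple), and suppose that $R$ is a left $H$-module algebra with $H\cdot R_i\subseteq R_i$ for all $i$. Let $R^H=\{r\in R\mid h\cdot r=\varepsilon(h)r\ \text{for all } h\in H\}$ be the invariant subring and $R\#H$ the smash product, graded by $(R^H)_i=R^H\cap R_i$ and $(R\#H)_i=R_i\otimes H$. Put $$\mathsf p(R,H)=\operatorname{GKdim}R-\operatorname{GKdim}\bigl((R\#H)/I\bigr),$$ where $I$ is the two-sided ideal generated by $1\#\int$. Here $\operatorname{GKdim}B=\sup_V\limsup_{n\to\infty}\log_n\dim_\Bbbk V^n$ for an algebra $B$, and $\operatorname{GKdim}M=\sup_{V,W}\limsup_{n\to\infty}\log_n\dim_\Bbbk WV^n$ for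 a right $B$-module $M$, where $V\subseteq B$ and $W\subseteq M$ run over the finite-dimensional subspaces and $\log_n 0=-\infty$; thus the zero algebra and zero modules have GK-dimension $-\infty$, and $\mathsf p(R,H)=+\infty$ if $I=R\#H$. For an $\mathbb N$-graded algebra $B$ and a real number $s$, let $\operatorname{gr}B$ be the category of finitely generated $\mathbb Z$-graded right $B$-modules with degree-preserving homomorphisms, let $\operatorname{gr}_sB$ be its full subcategory of modules of GK-dimension at most $s$, and let $\operatorname{qgr}_sB=\operatorname{gr}B/\operatorname{gr}_sB$ be the quotient category, i.e. the localization of $\operatorname{gr}B$ at the morphisms whose kernel and cokernel lie in $\operatorname{gr}_sB$. Then for every integer $\alpha\le\mathsf p(R,H)$ there is an equivalence of categories $$\operatorname{qgr}_{d-\alpha}R^H\;\cong\;\operatorname{qgr}_{d-\alpha}R\#H.$$ -/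

import Mathlib

open CategoryTheory TensorProduct

universe u v w

noncomputable section

/-! ## Hopf actions, smash products and invariants -/

/-- The action of `H` on `R` as a linear map `H ⊗ R → R`, `h ⊗ r ↦ h • r`, in curried form. -/
def hopfAct (k : Type u) (R : Type v) (H : Type w) [CommRing k] [Ring R] [Algebra k R] [Ring H]
    [Algebra k H] [Module H R] [IsScalarTower k H R] : H →ₗ[k] R →ₗ[k] R :=
  (Algebra.lsmul k k R : H →ₐ[k] Module.End k R).toLinearMap

/-- `R` is a left `H`-module algebra: `h • 1 = ε(h) 1` and `h • (a b) = ∑ (h₁ • a) (h₂ • b)`. -/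
class IsHModuleAlgebra (k : Type u) (R : Type v) (H : Type w) [CommRing k] [Ring R] [Algebra k R]
    [Ring H] [HopfAlgebra k H] [Module H R] [IsScalarTower k H R] : Prop where
  smul_one : ∀ h : H, h • (1 : R) = algebraMap k R (Coalgebra.counit h)
  smul_mul : ∀ (h : H) (a b : R), h • (a * b) =
    LinearMap.mul' k R
      (TensorProduct.map ((hopfAct k R H).flip a) ((hopfAct k R H).flip b) (Coalgebra.comul h))

/-- The underlying vector space `R ⊗ H` of the smash product `R # H`. -/
def SmashProduct (k : Type u) (R : Type v) (H : Type w) [CommRing k] [Ring R] [Algebra k R]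
    [Ring H] [Algebra k H] : Type (max v w) := R ⊗[k] H

namespace SmashProduct

variable {k : Type u} {R : Type v} {H : Type w} [CommRing k] [Ring R] [Algebra k R]

section Additive

variable [Ring H] [Algebra k H]

instance : AddCommGroup (SmashProduct k R H) := inferInstanceAs (AddCommGroup (R ⊗[k] H))

instance : Module k (SmashProduct k R H) := inferInstanceAs (Module k (R ⊗[k] H))

/-- The element `r # h` of the smash product. -/
def mk (k : Type u) {R : Type v} {H : Type w} [CommRing k] [Ring R] [Algebra k R]
    [Ring H] [Algebra k H] (r : R) (h : H) : SmashProduct k R H := (r ⊗ₜ[k] h : R ⊗[k] H)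

instance : One (SmashProduct k R H) := ⟨mk k 1 1⟩

theorem one_def : (1 : SmashProduct k R H) = mk k 1 1 := rfl

theorem ind {p : SmashProduct k R H → Prop} (x : SmashProduct k R H) (h0 : p 0)
    (hmk : ∀ r h, p (mk k r h)) (hadd : ∀ x y, p x → p y → p (x + y)) : p x :=
  TensorProduct.induction_on (motive := p) x h0 hmk hadd

theorem mk_sum_left {ι : Type*} (s : Finset ι) (f : ι → R) (h : H) :
    mk k (∑ i ∈ s, f i) h = ∑ i ∈ s, mk k (f i) h :=
  TensorProduct.sum_tmul (R := k) s f h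

theorem mk_sum_right {ι : Type*} (s : Finset ι) (f : ι → H) (r : R) :
    mk k r (∑ i ∈ s, f i) = ∑ i ∈ s, mk k r (f i) :=
  TensorProduct.tmul_sum (R := k) r s f

end Additive

variable [Ring H] [HopfAlgebra k H] [Module H R] [IsScalarTower k H R]

/-- The linear map `H ⊗ R → R ⊗ H`, `h ⊗ r ↦ ∑ (h₁ • r) ⊗ h₂`. -/
def twist (k : Type u) (R : Type v) (H : Type w) [CommRing k] [Ring R] [Algebra k R]
    [Ring H] [HopfAlgebra k H] [Module H R] [IsScalarTower k H R] : H ⊗[k] R →ₗ[k] R ⊗[k] H :=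
  (TensorProduct.lift (hopfAct k R H)).rTensor H ∘ₗ
    (TensorProduct.assoc k H R H).symm.toLinearMap ∘ₗ
    (TensorProduct.comm k H R).toLinearMap.lTensor H ∘ₗ
    (TensorProduct.assoc k H H R).toLinearMap ∘ₗ
    (Coalgebra.comul : H →ₗ[k] H ⊗[k] H).rTensor R

/-- The multiplication of the smash product as a linear map on
`(R ⊗ H) ⊗ (R ⊗ H)`: `(r ⊗ h) ⊗ (s ⊗ g) ↦ ∑ r (h₁ • s) ⊗ h₂ g`. -/
def mulMap (k : Type u) (R : Type v) (H : Type w) [CommRing k] [Ring R] [Algebra k R]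
    [Ring H] [HopfAlgebra k H] [Module H R] [IsScalarTower k H R] :
    (R ⊗[k] H) ⊗[k] (R ⊗[k] H) →ₗ[k] R ⊗[k] H :=
  TensorProduct.map (LinearMap.mul' k R) (LinearMap.mul' k H) ∘ₗ
    (TensorProduct.assoc k R R (H ⊗[k] H)).symm.toLinearMap ∘ₗ
    (TensorProduct.assoc k R H H).toLinearMap.lTensor R ∘ₗ
    ((twist k R H).rTensor H).lTensor R ∘ₗ
    (TensorProduct.assoc k H R H).symm.toLinearMap.lTensor R ∘ₗ
    (TensorProduct.assoc k R H (R ⊗[k] H)).toLinearMap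

instance : Mul (SmashProduct k R H) := ⟨fun x y => mulMap k R H (x ⊗ₜ[k] y)⟩

theorem mul_def (x y : SmashProduct k R H) : x * y = mulMap k R H (x ⊗ₜ[k] y) := rfl

theorem twist_tmul {ι : Type*} {h : H} (rep : Coalgebra.Repr k h ι) (r : R) :
    twist k R H (h ⊗ₜ[k] r) = ∑ i ∈ rep.index, (rep.left i • r) ⊗ₜ[k] rep.right i := by
  simp only [twist, LinearMap.comp_apply, LinearMap.rTensor_tmul, ← rep.eq,
    TensorProduct.sum_tmul, map_sum]
  rfl

/-- The defining formula `(r # h) (s # g) = ∑ r (h₁ • s) # h₂ g`. -/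
theorem mk_mul_mk {ι : Type*} {h : H} (rep : Coalgebra.Repr k h ι) (r s : R) (g : H) :
    mk k r h * mk k s g =
      ∑ i ∈ rep.index, mk k (r * (rep.left i • s)) (rep.right i * g) := by
  rw [mul_def]
  simp only [mulMap, mk, LinearMap.comp_apply, LinearEquiv.coe_coe, TensorProduct.assoc_tmul,
    LinearMap.lTensor_tmul, TensorProduct.assoc_symm_tmul, LinearMap.rTensor_tmul]
  rw [twist_tmul rep]
  simp only [TensorProduct.sum_tmul, TensorProduct.tmul_sum, map_sum, TensorProduct.assoc_tmul,
    TensorProduct.assoc_symm_tmul, TensorProduct.map_tmul, LinearMap.mul'_apply]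
  rfl

protected theorem add_mul' (x y z : SmashProduct k R H) : (x + y) * z = x * z + y * z := by
  simp only [mul_def]
  exact (congrArg (mulMap k R H) (TensorProduct.add_tmul (R := k) (M := R ⊗[k] H)
    (N := R ⊗[k] H) x y z)).trans (map_add _ _ _)

protected theorem mul_add' (x y z : SmashProduct k R H) : x * (y + z) = x * y + x * z := by
  simp only [mul_def]
  exact (congrArg (mulMap k R H) (TensorProduct.tmul_add (R := k) (M := R ⊗[k] H)
    (N := R ⊗[k] H) x y z)).trans (map_add _ _ _)

protected theorem smul_mul' (c : k) (x y : SmashProduct k R H) : (c • x) * y = c • (x * y) := by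
  simp only [mul_def]
  exact (congrArg (mulMap k R H) (TensorProduct.smul_tmul' (R := k) (M := R ⊗[k] H)
    (N := R ⊗[k] H) c x y).symm).trans (map_smul _ _ _)

protected theorem mul_smul' (c : k) (x y : SmashProduct k R H) : x * (c • y) = c • (x * y) := by
  simp only [mul_def]
  exact (congrArg (mulMap k R H) (TensorProduct.tmul_smul (R := k) (M := R ⊗[k] H)
    (N := R ⊗[k] H) c x y)).trans (map_smul _ _ _)

protected theorem zero_mul' (x : SmashProduct k R H) : 0 * x = 0 := by
  have := SmashProduct.smul_mul' (0 : k) x x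
  rwa [zero_smul, zero_smul] at this

protected theorem mul_zero' (x : SmashProduct k R H) : x * 0 = 0 := by
  have := SmashProduct.mul_smul' (0 : k) x x
  rwa [zero_smul, zero_smul] at this

theorem sum_mul' {ι : Type*} (s : Finset ι) (f : ι → SmashProduct k R H)
    (y : SmashProduct k R H) : (∑ i ∈ s, f i) * y = ∑ i ∈ s, f i * y :=
  map_sum (AddMonoidHom.mk' (fun x => x * y) fun a b => SmashProduct.add_mul' a b y) f s

theorem mul_sum' {ι : Type*} (s : Finset ι) (f : ι → SmashProduct k R H)
    (y : SmashProduct k R H) : y * (∑ i ∈ s, f i) = ∑ i ∈ s, y * f i :=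
  map_sum (AddMonoidHom.mk' (fun x => y * x) fun a b => SmashProduct.mul_add' y a b) f s

theorem one_mul_mk (r : R) (h : H) : 1 * mk k r h = mk k r h := by
  let rep : Coalgebra.Repr k (1 : H) Unit :=
    { index := {()}, left := fun _ => 1, right := fun _ => 1,
      eq := by simp [Algebra.TensorProduct.one_def] }
  rw [one_def, mk_mul_mk rep]
  simp [rep]

protected theorem one_mul' (x : SmashProduct k R H) : 1 * x = x := by
  induction x using ind with
  | h0 => exact SmashProduct.mul_zero' _
  | hmk r h => exact one_mul_mk r h
  | hadd x y hx hy => rw [SmashProduct.mul_add', hx, hy]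

variable [IsHModuleAlgebra k R H]

theorem smul_mul_repr {ι : Type*} {h : H} (rep : Coalgebra.Repr k h ι) (a b : R) :
    h • (a * b) = ∑ i ∈ rep.index, (rep.left i • a) * (rep.right i • b) := by
  rw [IsHModuleAlgebra.smul_mul (k := k), ← rep.eq]
  simp only [map_sum]
  rfl

theorem mk_mul_one (r : R) (h : H) : mk k r h * 1 = mk k r h := by
  let rep := Coalgebra.Repr.arbitrary k h
  rw [one_def, mk_mul_mk rep]
  have h1 : ∀ x : H, x • (1 : R) = algebraMap k R (Coalgebra.counit x) :=
    IsHModuleAlgebra.smul_one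
  have h2 : ∀ i, mk k (r * (rep.left i • (1 : R))) (rep.right i * 1) =
      mk k r (Coalgebra.counit (R := k) (rep.left i) • rep.right i) := fun i => by
    rw [h1, mul_one, ← Algebra.commutes, ← Algebra.smul_def]
    exact TensorProduct.smul_tmul _ _ _
  simp only [h2]
  rw [← mk_sum_right, Coalgebra.sum_counit_smul]

theorem mk_mul_mk_mul_mk (r s u : R) (h g f : H) :
    mk k r h * mk k s g * mk k u f = mk k r h * (mk k s g * mk k u f) := by
  let rh := Coalgebra.Repr.arbitrary k h
  let rg := Coalgebra.Repr.arbitrary k g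
  let rl := fun i => Coalgebra.Repr.arbitrary k (rh.left i)
  let rr := fun i => Coalgebra.Repr.arbitrary k (rh.right i)
  let rm : ∀ i, Coalgebra.Repr k (rh.right i * g) ((H × H) × (H × H)) := fun i =>
    { index := (rr i).index ×ˢ rg.index
      left := fun p => (rr i).left p.1 * rg.left p.2
      right := fun p => (rr i).right p.1 * rg.right p.2
      eq := by
        rw [Bialgebra.comul_mul, ← (rr i).eq, ← rg.eq, Finset.sum_mul_sum,
          Finset.sum_product]
        simp only [Algebra.TensorProduct.tmul_mul_tmul] }
  have hL : mk k r h * mk k s g * mk k u f = ∑ l ∈ rg.index, ∑ i ∈ rh.index,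
      ∑ j ∈ (rr i).index, mk k (r * (rh.left i • s) * ((rr i).left j • rg.left l • u))
        ((rr i).right j * (rg.right l * f)) := by
    rw [mk_mul_mk rh, sum_mul']
    have : ∀ i, mk k (r * (rh.left i • s)) (rh.right i * g) * mk k u f =
        ∑ l ∈ rg.index, ∑ j ∈ (rr i).index,
          mk k (r * (rh.left i • s) * ((rr i).left j • rg.left l • u))
            ((rr i).right j * (rg.right l * f)) := fun i => by
      rw [mk_mul_mk (rm i)]
      simp only [rm, Finset.sum_product, mul_smul, mul_assoc]
      rw [Finset.sum_comm]
    simp only [this]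
    rw [Finset.sum_comm]
  have hR : mk k r h * (mk k s g * mk k u f) = ∑ l ∈ rg.index, ∑ i ∈ rh.index,
      ∑ j ∈ (rl i).index, mk k (r * ((rl i).left j • s) * ((rl i).right j • rg.left l • u))
        (rh.right i * (rg.right l * f)) := by
    rw [mk_mul_mk rg, mul_sum']
    refine Finset.sum_congr rfl fun l _ => ?_
    rw [mk_mul_mk rh]
    refine Finset.sum_congr rfl fun i _ => ?_
    rw [smul_mul_repr (rl i), Finset.mul_sum, mk_sum_left]
    simp only [mul_assoc]
  rw [hL, hR]
  refine Finset.sum_congr rfl fun l _ => ?_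
  have key := congrArg (TensorProduct.map (LinearMap.mul' k R) LinearMap.id ∘ₗ
    (TensorProduct.assoc k R R H).symm.toLinearMap ∘ₗ
    TensorProduct.map (LinearMap.mulLeft k r ∘ₗ (hopfAct k R H).flip s)
      (TensorProduct.map ((hopfAct k R H).flip (rg.left l • u))
        (LinearMap.mulRight k (rg.right l * f)))) (Coalgebra.sum_tmul_tmul_eq rh rl rr)
  simp only [map_sum] at key
  exact key.symm

protected theorem mul_one' (x : SmashProduct k R H) : x * 1 = x := by
  induction x using ind with
  | h0 => exact SmashProduct.zero_mul' _
  | hmk r h => exact mk_mul_one r h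
  | hadd x y hx hy => rw [SmashProduct.add_mul', hx, hy]

protected theorem mul_assoc' (x y z : SmashProduct k R H) : x * y * z = x * (y * z) := by
  induction x using ind with
  | h0 => simp only [SmashProduct.zero_mul']
  | hadd x x' hx hx' => simp only [SmashProduct.add_mul', hx, hx']
  | hmk r h =>
    induction y using ind with
    | h0 => simp only [SmashProduct.zero_mul', SmashProduct.mul_zero']
    | hadd x x' hx hx' => simp only [SmashProduct.add_mul', SmashProduct.mul_add', hx, hx']
    | hmk s g =>
      induction z using ind with
      | h0 => simp only [SmashProduct.mul_zero']
      | hadd x x' hx hx' => simp only [SmashProduct.mul_add', hx, hx']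
      | hmk u f => exact mk_mul_mk_mul_mk r s u h g f

instance : Ring (SmashProduct k R H) :=
  { (inferInstance : AddCommGroup (SmashProduct k R H)) with
    mul := (· * ·)
    one := 1
    left_distrib := SmashProduct.mul_add'
    right_distrib := SmashProduct.add_mul'
    zero_mul := SmashProduct.zero_mul'
    mul_zero := SmashProduct.mul_zero'
    mul_assoc := SmashProduct.mul_assoc'
    one_mul := SmashProduct.one_mul'
    mul_one := SmashProduct.mul_one' }

instance : Algebra k (SmashProduct k R H) :=
  Algebra.ofModule SmashProduct.smul_mul' SmashProduct.mul_smul'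

/-- The degree `n` part `𝒜 n ⊗ H` of the smash product (`H` sits in degree `0`). -/
def grading (k : Type u) {R : Type v} (H : Type w) [CommRing k] [Ring R] [Algebra k R]
    [Ring H] [Algebra k H] (𝒜 : ℕ → Submodule k R) (n : ℕ) : Submodule k (SmashProduct k R H) :=
  LinearMap.range ((𝒜 n).subtype.rTensor H)

end SmashProduct

/-- The invariant subring `R^H = {r | h • r = ε(h) r for all h}`. -/
def hopfInvariants (k : Type u) (R : Type v) (H : Type w) [CommRing k] [Ring R] [Algebra k R]
    [Ring H] [HopfAlgebra k H] [Module H R] [IsScalarTower k H R] [IsHModuleAlgebra k R H] :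
    Subalgebra k R where
  carrier := {r | ∀ h : H, h • r = (Coalgebra.counit h : k) • r}
  mul_mem' {a b} ha hb h := by
    let rep := Coalgebra.Repr.arbitrary k h
    rw [SmashProduct.smul_mul_repr rep]
    simp only [ha _, hb _, smul_mul_smul_comm, ← Finset.sum_smul]
    congr 1
    have := congrArg (Coalgebra.counit (R := k)) (Coalgebra.sum_counit_smul rep)
    simpa only [map_sum, map_smul, smul_eq_mul] using this
  add_mem' {a b} ha hb h := by rw [smul_add, ha h, hb h, smul_add]
  algebraMap_mem' c h := by
    rw [Algebra.algebraMap_eq_smul_one, smul_comm, IsHModuleAlgebra.smul_one (k := k),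
      Algebra.algebraMap_eq_smul_one, smul_comm]

/-- The degree `n` part of `R^H`. -/
def hopfInvariantsGrading {k : Type u} {R : Type v} (H : Type w) [CommRing k] [Ring R]
    [Algebra k R] [Ring H] [HopfAlgebra k H] [Module H R] [IsScalarTower k H R]
    [IsHModuleAlgebra k R H] (𝒜 : ℕ → Submodule k R) (n : ℕ) :
    Submodule k (hopfInvariants k R H) :=
  (𝒜 n).comap (hopfInvariants k R H).val.toLinearMap

/-- `t` is a left and right integral of `H` with `ε(t) = 1`. -/
structure IsNormalizedIntegral (k : Type u) {H : Type w} [CommRing k] [Ring H] [HopfAlgebra k H]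
    (t : H) : Prop where
  left : ∀ h : H, h * t = (Coalgebra.counit h : k) • t
  right : ∀ h : H, t * h = (Coalgebra.counit h : k) • t
  counit_eq_one : (Coalgebra.counit t : k) = 1

/-! ## Gelfand-Kirillov dimension and pertinency -/

/-- `log_n m` for a dimension `m`, with `log_n 0 = -∞`. -/
def dimLog (n m : ℕ) : EReal := if m = 0 then ⊥ else ((Real.logb n m : ℝ) : EReal)

/-- The Gelfand-Kirillov dimension of a `k`-algebra:
`sup_V limsup_n log_n (dim V ^ n)` over finite-dimensional subspaces `V`. -/
def gkDim (k : Type u) (B : Type v) [Field k] [Ring B] [Algebra k B] : EReal :=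
  ⨆ (V : Submodule k B) (_ : V.FG),
    Filter.limsup (fun n : ℕ => dimLog n (Module.finrank k (V ^ n : Submodule k B))) Filter.atTop

/-- The Gelfand-Kirillov dimension of a right `B`-module (a `Bᵐᵒᵖ`-module):
`sup_{V,W} limsup_n log_n (dim W V ^ n)` over finite-dimensional subspaces `V ⊆ B`, `W ⊆ M`. -/
def gkDimModule (k : Type u) (B : Type v) (M : Type w) [Field k] [Ring B] [Algebra k B]
    [AddCommGroup M] [Module k M] [Module Bᵐᵒᵖ M] : EReal :=
  ⨆ (V : Submodule k B) (_ : V.FG) (W : Submodule k M) (_ : W.FG),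
    Filter.limsup (fun n : ℕ => dimLog n (Module.finrank k
      (Submodule.span k {x : M | ∃ w ∈ W, ∃ b ∈ V ^ n, x = MulOpposite.op b • w}))) Filter.atTop

/-- The quotient `(R # H) / I`, with `I` the two-sided ideal generated by `1 # t`. -/
abbrev SmashQuotient (k : Type u) (R : Type v) {H : Type w} [CommRing k] [Ring R] [Algebra k R]
    [Ring H] [HopfAlgebra k H] [Module H R] [IsScalarTower k H R] [IsHModuleAlgebra k R H]
    (t : H) : Type (max v w) :=
  (TwoSidedIdeal.span {SmashProduct.mk k (1 : R) t}).ringCon.Quotient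

/-- The pertinency `p(R, H) = GKdim R - GKdim ((R # H) / (1 # t))`; it is meant for
`GKdim R < ∞`, and it is `+∞` when the quotient vanishes, since then `GKdim = -∞`. -/
def pertinency (k : Type u) (R : Type v) {H : Type w} [Field k] [Ring R] [Algebra k R]
    [Ring H] [HopfAlgebra k H] [Module H R] [IsScalarTower k H R] [IsHModuleAlgebra k R H]
    (t : H) : EReal :=
  gkDim k R - gkDim k (SmashQuotient k R t)

/-! ## Finitely generated graded right modules and their quotient categories -/

/-- An object of `gr B`: a finitely generated `ℤ`-graded right module over the algebra `B` with
grading `ℬ`. Right `B`-modules are `Bᵐᵒᵖ`-modules. -/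
structure GrMod {k : Type u} {B : Type u} [Field k] [Ring B] [Algebra k B]
    (ℬ : ℕ → Submodule k B) : Type (u + 1) where
  carrier : Type u
  [addCommGroup : AddCommGroup carrier]
  [moduleBase : Module k carrier]
  [moduleOp : Module Bᵐᵒᵖ carrier]
  [isScalarTower : IsScalarTower k Bᵐᵒᵖ carrier]
  [finite : Module.Finite Bᵐᵒᵖ carrier]
  deg : ℤ → Submodule k carrier
  isInternal : DirectSum.IsInternal deg
  smul_mem : ∀ (i : ℕ) (j : ℤ) (b : B) (m : carrier), b ∈ ℬ i → m ∈ deg j →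
    MulOpposite.op b • m ∈ deg (j + i)

namespace GrMod

attribute [instance] addCommGroup moduleBase moduleOp isScalarTower finite

variable {k : Type u} {B : Type u} [Field k] [Ring B] [Algebra k B] {ℬ : ℕ → Submodule k B}

/-- Morphisms of `gr B`: module homomorphisms preserving the degree. -/
@[ext]
structure Hom (M N : GrMod ℬ) : Type u where
  toLinearMap : M.carrier →ₗ[Bᵐᵒᵖ] N.carrier
  map_deg : ∀ (j : ℤ) (m : M.carrier), m ∈ M.deg j → toLinearMap m ∈ N.deg j

instance : Category (GrMod ℬ) where
  Hom M N := Hom M N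
  id M := ⟨LinearMap.id, fun _ _ h => h⟩
  comp f g := ⟨g.toLinearMap ∘ₗ f.toLinearMap, fun j m h => g.map_deg j _ (f.map_deg j m h)⟩

/-- The morphisms of `gr B` whose kernel and cokernel lie in `gr_n B`, that is, have
Gelfand-Kirillov dimension at most `n`. -/
def isoModGKDim (ℬ : ℕ → Submodule k B) (n : EReal) : MorphismProperty (GrMod ℬ) :=
  fun M N (f : Hom M N) =>
    gkDimModule k B (LinearMap.ker f.toLinearMap) ≤ n ∧
      gkDimModule k B (N.carrier ⧸ LinearMap.range f.toLinearMap) ≤ n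

end GrMod

/-- The quotient category `qgr_n B = gr B / gr_n B`: the localization of `gr B` at the morphisms
whose kernel and cokernel lie in `gr_n B`. -/
abbrev Qgr {k : Type u} {B : Type u} [Field k] [Ring B] [Algebra k B]
    (ℬ : ℕ → Submodule k B) (n : EReal) : Type (u + 1) :=
  (GrMod.isoModGKDim ℬ n).Localization

end

noncomputable section

/-! ## Growth estimates -/

/-! Write `A = R^H` and `B = R#H`. The element `e = 1#∫` is an idempotent of degree 0 commuting with
`A`, and `a ↦ a e` identifies `A` with the corner `eBe`; the structure `Corner` records this. The
functors `M ↦ Me` and `N ↦ N ⊗_A eB` between graded right modules satisfy `(N ⊗_A eB)e ≅ N`, while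
the counit `Me ⊗_A eB → M` has kernel and cokernel killed by `e`, because it becomes an isomorphism
after applying `(-)e`.

A finitely generated `B`-module killed by `e` is a module over `B/(e)`, so its GK-dimension is at
most `GKdim B/(e)` (`gkDimModule_le_gkDim_of_quotient`). The condition `α ≤ p(R,H)` says that this
is at most `d - α`. Hence the counit is inverted in the quotient category.

Both functors must also respect GK-dimension. Restriction is exact, and `Me` grows no faster over
`A` than `M` does over `B` (`gkDimModule_le_of_injective`). For induction, `eB` is a finitely
generated left `A`-module since `B` is left noetherian, so a `B`-module generated by an image of `N`
inside `Me` grows no faster than `N` (`gkDimModule_le_of_span_eq_top`). Induction is only right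
exact, but the kernel it creates on an injection is again killed by `e`. Both functors therefore
descend to the localizations, where they are mutually inverse (`nonempty_qgr_equivalence`).

It remains that `B` is noetherian on both sides. On the left this follows from `B = R·H` with `H`
finite-dimensional. On the right one needs `B = H·R`, hence an inverse of the antipode, which comes
from the normalized integral (`IsNormalizedIntegral.antipode_injective`). -/

theorem limsup_dimLog_le_of_le_mul {f g : ℕ → ℕ} (c : ℕ) (h : ∀ n, 1 ≤ n → f n ≤ c * g n) :
    Filter.limsup (fun n => dimLog n (f n)) Filter.atTop ≤
      Filter.limsup (fun n => dimLog n (g n)) Filter.atTop := by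
  -- The factor `c` only costs `log_n (c + 1)`, which tends to 0. Using `c + 1` keeps the logarithm
  -- meaningful when `c = 0`.
  have hu : Filter.Tendsto (fun n : ℕ => ((Real.logb n (c + 1 : ℝ) : ℝ) : EReal))
      Filter.atTop (nhds ((0 : ℝ) : EReal)) := by
    refine (continuous_coe_real_ereal.tendsto 0).comp ?_
    exact Filter.Tendsto.div_atTop tendsto_const_nhds
      (Real.tendsto_log_atTop.comp tendsto_natCast_atTop_atTop)
  have hle : ∀ᶠ n : ℕ in Filter.atTop, dimLog n (f n) ≤
      ((fun n : ℕ => ((Real.logb n (c + 1 : ℝ) : ℝ) : EReal)) + fun n => dimLog n (g n)) n := by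
    filter_upwards [Filter.eventually_ge_atTop 2] with n hn
    have hfg := h n (by omega)
    have hn1 : (1 : ℝ) < n := by exact_mod_cast hn
    simp only [Pi.add_apply, dimLog]
    split_ifs with h1 h2 h2
    · simp
    · simp
    · simp [h2] at hfg; exact absurd hfg h1
    · rw [← EReal.coe_add, EReal.coe_le_coe_iff, ← Real.logb_mul (by positivity) (by positivity)]
      refine Real.logb_le_logb_of_le hn1 (by positivity) ?_
      have : (f n : ℝ) ≤ c * g n := by exact_mod_cast hfg
      nlinarith [(Nat.cast_nonneg (g n) : (0 : ℝ) ≤ g n)]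
  refine (Filter.limsup_le_limsup hle).trans ?_
  have h0 := hu.limsup_eq
  -- The side conditions exclude `⊥ + ⊤`; they hold because the first summand has limit 0.
  refine (EReal.limsup_add_le ?_ ?_).trans ?_
  · left; rw [h0]; simp
  · left; rw [h0]; simp
  · rw [h0]; simp

/-! ### Growth of right modules, in terms of the subspaces `W V ^ n`. -/

section RightAction

variable {k : Type u} {B : Type v} [Field k] [Ring B] [Algebra k B]
variable {M : Type w} [AddCommGroup M] [Module k M] [Module Bᵐᵒᵖ M] [IsScalarTower k Bᵐᵒᵖ M]

/-- The right action of an algebra on a module as a bilinear map. -/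
def rightAct (k : Type u) (B : Type v) (M : Type w) [Field k] [Ring B] [Algebra k B]
    [AddCommGroup M] [Module k M] [Module Bᵐᵒᵖ M] [IsScalarTower k Bᵐᵒᵖ M] :
    M →ₗ[k] B →ₗ[k] M :=
  LinearMap.mk₂ k (fun m b => MulOpposite.op b • m) (fun _ _ _ => smul_add _ _ _)
    (fun c m b => smul_comm _ _ _) (fun _ _ _ => add_smul _ _ _)
    (fun c m b => by rw [MulOpposite.op_smul, smul_assoc])

@[simp]
theorem rightAct_apply (m : M) (b : B) : rightAct k B M m b = MulOpposite.op b • m := rfl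

theorem rightAct_mul (m : M) (b c : B) :
    rightAct k B M m (b * c) = rightAct k B M (rightAct k B M m b) c := by
  simp [mul_smul]

theorem span_rightAct_eq_map₂ (W : Submodule k M) (V : Submodule k B) :
    Submodule.span k {x : M | ∃ w ∈ W, ∃ b ∈ V, x = MulOpposite.op b • w} =
      Submodule.map₂ (rightAct k B M) W V := by
  rw [Submodule.map₂_eq_span_image2]
  congr 1
  ext x
  simp [Set.mem_image2, eq_comm]

/-- The growth of `W V ^ n`. -/
def growthDegree (W : Submodule k M) (V : Submodule k B) : EReal :=
  Filter.limsup (fun n : ℕ => dimLog n (Module.finrank k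
    (Submodule.map₂ (rightAct k B M) W (V ^ n)))) Filter.atTop

theorem gkDimModule_eq : gkDimModule k B M =
    ⨆ (V : Submodule k B) (_ : V.FG) (W : Submodule k M) (_ : W.FG), growthDegree W V := by
  have h (W : Submodule k M) (V : Submodule k B) : Module.finrank k
      (Submodule.span k {x : M | ∃ w ∈ W, ∃ b ∈ V, x = MulOpposite.op b • w}) =
      Module.finrank k (Submodule.map₂ (rightAct k B M) W V) := by rw [span_rightAct_eq_map₂]
  simp only [gkDimModule, h, growthDegree]

theorem growthDegree_le_gkDimModule {W : Submodule k M} {V : Submodule k B} (hW : W.FG)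
    (hV : V.FG) : growthDegree W V ≤ gkDimModule k B M := by
  rw [gkDimModule_eq]
  exact le_iSup₂_of_le V hV (le_iSup₂_of_le W hW le_rfl)

theorem gkDimModule_le {s : EReal} (h : ∀ (V : Submodule k B) (W : Submodule k M), V.FG → W.FG →
    growthDegree W V ≤ s) : gkDimModule k B M ≤ s := by
  rw [gkDimModule_eq]
  exact iSup₂_le fun V hV => iSup₂_le fun W hW => h V W hV hW

theorem map₂_rightAct_mul (W : Submodule k M) (V V' : Submodule k B) :
    Submodule.map₂ (rightAct k B M) W (V * V') =
      Submodule.map₂ (rightAct k B M) (Submodule.map₂ (rightAct k B M) W V) V' := by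
  apply le_antisymm
  · rw [Submodule.map₂_le]
    intro m hm b hb
    induction hb using Submodule.mul_induction_on' with
    | mem_mul_mem x hx y hy =>
      rw [rightAct_mul]
      exact Submodule.apply_mem_map₂ _ (Submodule.apply_mem_map₂ _ hm hx) hy
    | add x _ y _ hx hy => rw [map_add]; exact add_mem hx hy
  · rw [Submodule.map₂_le]
    intro m hm b hb
    have : Submodule.map₂ (rightAct k B M) W V ≤
        (Submodule.map₂ (rightAct k B M) W (V * V')).comap ((rightAct k B M).flip b) := by
      rw [Submodule.map₂_le]
      intro m hm c hc
      rw [Submodule.mem_comap, LinearMap.flip_apply, ← rightAct_mul]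
      exact Submodule.apply_mem_map₂ _ hm (Submodule.mul_mem_mul hc hb)
    exact this hm

theorem fg_map₂_rightAct_pow {W : Submodule k M} {V : Submodule k B} (hW : W.FG) (hV : V.FG)
    (n : ℕ) : (Submodule.map₂ (rightAct k B M) W (V ^ n)).FG :=
  hW.map₂ _ (hV.pow n)

theorem gkDimModule_of_subsingleton [Subsingleton M] : gkDimModule k B M = ⊥ := by
  rw [eq_bot_iff]
  refine gkDimModule_le fun V W _ _ => ?_
  simp [growthDegree, dimLog, Module.finrank_zero_of_subsingleton]

end RightAction

/-! ### Finite-dimensional subspaces and bilinear maps. -/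

section Image2

variable {k X Y Z : Type*} [Field k] [AddCommGroup X] [Module k X] [AddCommGroup Y] [Module k Y]
  [AddCommGroup Z] [Module k Z]

theorem Submodule.finrank_map₂_le (f : X →ₗ[k] Y →ₗ[k] Z) {P : Submodule k X}
    {Q : Submodule k Y} (hP : P.FG) (hQ : Q.FG) :
    Module.finrank k (Submodule.map₂ f P Q) ≤ Module.finrank k Q * Module.finrank k P := by
  have : Module.Finite k P := Module.Finite.iff_fg.2 hP
  have : Module.Finite k Q := Module.Finite.iff_fg.2 hQ
  have : Submodule.map₂ f P Q = LinearMap.range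
      (TensorProduct.lift (f.compl₁₂ P.subtype Q.subtype)) := by
    apply le_antisymm
    · rw [Submodule.map₂_le]
      exact fun m hm n hn => ⟨(⟨m, hm⟩ : P) ⊗ₜ (⟨n, hn⟩ : Q), by simp⟩
    · rintro _ ⟨x, rfl⟩
      induction x with
      | zero => simp
      | tmul m n => exact Submodule.apply_mem_map₂ _ m.2 n.2
      | add x y hx hy => rw [map_add]; exact add_mem hx hy
  rw [this]
  refine (LinearMap.finrank_range_le _).trans ?_
  rw [Module.finrank_tensorProduct, mul_comm]

/-- A finite-dimensional subspace of the space spanned by the image of a bilinear map comes from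
finite-dimensional subspaces. -/
theorem Submodule.exists_fg_le_map₂ (f : X →ₗ[k] Y →ₗ[k] Z) {P : Submodule k X}
    {Q : Submodule k Y} {W : Submodule k Z} (hW : W.FG) (h : W ≤ Submodule.map₂ f P Q) :
    ∃ P' ≤ P, ∃ Q' ≤ Q, P'.FG ∧ Q'.FG ∧ W ≤ Submodule.map₂ f P' Q' := by
  have key : ∀ z ∈ Submodule.map₂ f P Q,
      ∃ P' ≤ P, ∃ Q' ≤ Q, P'.FG ∧ Q'.FG ∧ z ∈ Submodule.map₂ f P' Q' := by
    intro z hz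
    rw [Submodule.map₂_eq_span_image2] at hz
    induction hz using Submodule.span_induction with
    | mem z hz =>
      obtain ⟨x, hx, y, hy, rfl⟩ := hz
      exact ⟨k ∙ x, by simpa using hx, k ∙ y, by simpa using hy, Submodule.fg_span_singleton _,
        Submodule.fg_span_singleton _, Submodule.apply_mem_map₂ _
          (Submodule.mem_span_singleton_self _) (Submodule.mem_span_singleton_self _)⟩
    | zero => exact ⟨⊥, bot_le, ⊥, bot_le, Submodule.fg_bot, Submodule.fg_bot, zero_mem _⟩
    | add a b _ _ ha hb =>
      obtain ⟨P₁, h1, Q₁, h2, h3, h4, h5⟩ := ha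
      obtain ⟨P₂, h1', Q₂, h2', h3', h4', h5'⟩ := hb
      exact ⟨P₁ ⊔ P₂, sup_le h1 h1', Q₁ ⊔ Q₂, sup_le h2 h2', h3.sup h3', h4.sup h4',
        add_mem (Submodule.map₂_le_map₂ le_sup_left le_sup_left h5)
          (Submodule.map₂_le_map₂ le_sup_right le_sup_right h5')⟩
    | smul c a _ ha =>
      obtain ⟨P₁, h1, Q₁, h2, h3, h4, h5⟩ := ha
      exact ⟨P₁, h1, Q₁, h2, h3, h4, Submodule.smul_mem _ _ h5⟩
  classical
  obtain ⟨S, rfl⟩ := hW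
  induction S using Finset.induction_on with
  | empty => exact ⟨⊥, bot_le, ⊥, bot_le, Submodule.fg_bot, Submodule.fg_bot, by simp⟩
  | insert a S _ ih =>
    rw [Finset.coe_insert, Submodule.span_insert, sup_le_iff] at h
    obtain ⟨P₁, h1, Q₁, h2, h3, h4, h5⟩ := ih h.2
    obtain ⟨P₂, h1', Q₂, h2', h3', h4', h5'⟩ := key a (by simpa using h.1)
    refine ⟨P₁ ⊔ P₂, sup_le h1 h1', Q₁ ⊔ Q₂, sup_le h2 h2', h3.sup h3', h4.sup h4', ?_⟩
    rw [Finset.coe_insert, Submodule.span_insert, sup_le_iff]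
    exact ⟨by simpa using Submodule.map₂_le_map₂ le_sup_right le_sup_right h5',
      h5.trans (Submodule.map₂_le_map₂ le_sup_left le_sup_left)⟩

end Image2

/-! ## Corner rings -/

/-- An identification of an algebra `A` with the corner `e B e` of an algebra `B`, by means of an
algebra homomorphism `ι : A → B` commuting with `e`, as `a ↦ ι a * e`. -/
structure Corner (k A B : Type*) [Field k] [Ring A] [Algebra k A] [Ring B] [Algebra k B] where
  ι : A →ₐ[k] B
  e : B
  θ : B →ₗ[k] A
  idem : e * e = e
  comm : ∀ a, ι a * e = e * ι a
  compress : ∀ b, e * b * e = ι (θ b) * e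
  inj : ∀ a, ι a * e = 0 → a = 0

theorem Submodule.finrank_le_of_le_of_fg {k M : Type*} [Field k] [AddCommGroup M] [Module k M]
    {P Q : Submodule k M} (h : P ≤ Q) (hQ : Q.FG) : Module.finrank k P ≤ Module.finrank k Q := by
  have : Module.Finite k Q := Module.Finite.iff_fg.2 hQ
  exact Submodule.finrank_mono h

theorem map₂_rightAct_one {k B M : Type*} [Field k] [Ring B] [Algebra k B] [AddCommGroup M]
    [Module k M] [Module Bᵐᵒᵖ M] [IsScalarTower k Bᵐᵒᵖ M] (W : Submodule k M) :
    Submodule.map₂ (rightAct k B M) W 1 = W := by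
  apply le_antisymm
  · rw [Submodule.map₂_le]
    rintro m hm _ ⟨c, rfl⟩
    simpa [Algebra.algebraMap_eq_smul_one] using W.smul_mem c hm
  · intro m hm
    simpa using Submodule.apply_mem_map₂ (rightAct k B M) hm (Submodule.one_le.1 le_rfl)

namespace Corner

section

variable {k A B : Type*} [Field k] [Ring A] [Algebra k A] [Ring B] [Algebra k B]
variable (D : Corner k A B)

theorem eq_of_ι_mul_e {a a' : A} (h : D.ι a * D.e = D.ι a' * D.e) : a = a' := by
  rw [← sub_eq_zero]
  apply D.inj
  rw [map_sub, sub_mul, h, sub_self]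

theorem θ_ι_mul (a : A) (b : B) : D.θ (D.ι a * D.e * b) = a * D.θ b := by
  apply D.eq_of_ι_mul_e
  rw [← D.compress, map_mul, mul_assoc (D.ι a) (D.ι (D.θ b)), ← D.compress]
  simp only [← mul_assoc]
  rw [← D.comm, mul_assoc (D.ι a) D.e D.e, D.idem]

theorem θ_one : D.θ 1 = 1 := by
  apply D.eq_of_ι_mul_e
  rw [← D.compress, map_one, mul_one, one_mul, D.idem]

/-- This is finite generation of `eB` as a left `A`-module. The left ideal `BeB` has finitely many
generators `x` that can be chosen in `eB`; if `b = ∑ f_x x` lies in `eB`, then `b = eb = ∑ (e f_x e)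
x`, and `e f_x e` acts on `x` as `θ f_x`. -/
theorem exists_left_generators [IsNoetherianRing B] :
    ∃ s : Finset B, (∀ x ∈ s, D.e * x = x) ∧
      ∀ b, D.e * b = b → ∃ c : B → A, b = ∑ x ∈ s, D.ι (c x) * x := by
  obtain ⟨s, hs, hspan⟩ := (Submodule.fg_span_iff_fg_span_finset_subset {b : B | D.e * b = b}).1
    (IsNoetherian.noetherian (Submodule.span B {b : B | D.e * b = b}))
  refine ⟨s, hs, fun b hb => ?_⟩
  have hmem : b ∈ Submodule.span B (s : Set B) := by
    rw [← hspan]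
    exact Submodule.subset_span hb
  obtain ⟨f, -, hf⟩ := Submodule.mem_span_finset.1 hmem
  refine ⟨fun x => D.θ (f x), ?_⟩
  rw [← hb, ← hf, Finset.mul_sum]
  refine Finset.sum_congr rfl fun x hx => ?_
  have hx' : D.e * x = x := hs hx
  have h := congrArg (· * x) (D.compress (f x))
  simp only [mul_assoc, hx'] at h
  rw [smul_eq_mul, h]

variable {N M : Type*} [AddCommGroup N] [Module k N] [Module Aᵐᵒᵖ N] [IsScalarTower k Aᵐᵒᵖ N]
  [AddCommGroup M] [Module k M] [Module Bᵐᵒᵖ M] [IsScalarTower k Bᵐᵒᵖ M]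

/-- The embedding carries `W V ^ n` into `φ(W) ι(V) ^ n`. -/
theorem gkDimModule_le_of_injective (φ : N →ₗ[k] M)
    (hφ : ∀ a n, φ (MulOpposite.op a • n) = MulOpposite.op (D.ι a) • φ n)
    (hinj : Function.Injective φ) : gkDimModule k A N ≤ gkDimModule k B M := by
  refine gkDimModule_le fun V W hV hW => ?_
  refine le_trans ?_ (growthDegree_le_gkDimModule (hW.map φ) (hV.map D.ι.toLinearMap))
  refine limsup_dimLog_le_of_le_mul 1 fun n _ => ?_
  rw [one_mul, (Submodule.equivMapOfInjective φ hinj _).finrank_eq]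
  refine Submodule.finrank_le_of_le_of_fg ?_
    (fg_map₂_rightAct_pow (hW.map φ) (hV.map D.ι.toLinearMap) n)
  rw [Submodule.map_le_iff_le_comap, Submodule.map₂_le]
  intro m hm b hb
  rw [Submodule.mem_comap, rightAct_apply, hφ, ← rightAct_apply (k := k)]
  refine Submodule.apply_mem_map₂ _ (Submodule.mem_map_of_mem hm) ?_
  rw [← Submodule.map_pow]
  exact Submodule.mem_map_of_mem hb

/-- Let `F` be the span of finitely many generators of the left `A`-module `eB`. Since `φ(N)` lies
in `Me`, one has `M = φ(N) eB = φ(N) F`. If `W ⊆ φ(P) F` and `F V ⊆ ι(U) F`, then `W V ^ n ⊆ φ(P U ^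
n) F`, so passing from `A` to `B` multiplies dimensions by at most `dim F`. -/
theorem gkDimModule_le_of_span_eq_top [IsNoetherianRing B] (φ : N →ₗ[k] M)
    (hφ : ∀ a n, φ (MulOpposite.op a • n) = MulOpposite.op (D.ι a) • φ n)
    (hφe : ∀ n, MulOpposite.op D.e • φ n = φ n)
    (hspan : Submodule.span Bᵐᵒᵖ (Set.range φ) = ⊤) :
    gkDimModule k B M ≤ gkDimModule k A N := by
  obtain ⟨s, hs, hgen⟩ := D.exists_left_generators
  set f : N →ₗ[k] B →ₗ[k] M := rightAct k B M ∘ₗ φ with hf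
  have hfa : ∀ n b, f n b = MulOpposite.op b • φ n := fun _ _ => rfl
  set F : Submodule k B := Submodule.span k (s : Set B) with hF
  have hFfg : F.FG := ⟨s, rfl⟩
  have hFe : ∀ x ∈ F, D.e * x = x := fun x hx => by
    have : F ≤ LinearMap.eqLocus (LinearMap.mulLeft k D.e) LinearMap.id :=
      Submodule.span_le.2 hs
    exact this hx
  set g : A →ₗ[k] B →ₗ[k] B := LinearMap.mul k B ∘ₗ D.ι.toLinearMap with hg
  have hga : ∀ a x, g a x = D.ι a * x := fun _ _ => rfl
  have hfg : ∀ n a x, f n (g a x) = f (rightAct k A N n a) x := fun n a x => by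
    rw [hfa, hfa, hga, rightAct_apply, hφ, MulOpposite.op_mul, mul_smul]
  have hmemg : ∀ b, D.e * b = b → b ∈ Submodule.map₂ g ⊤ F := fun b hb => by
    obtain ⟨c, rfl⟩ := hgen b hb
    exact Submodule.sum_mem _ fun x hx =>
      Submodule.apply_mem_map₂ g Submodule.mem_top (Submodule.subset_span hx)
  have hT : ∀ (X : Submodule k N) (U : Submodule k A) (n : N) (y : B), n ∈ X →
      y ∈ Submodule.map₂ g U F →
      f n y ∈ Submodule.map₂ f (Submodule.map₂ (rightAct k A N) X U) F := by
    intro X U n y hn hy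
    have : Submodule.map₂ g U F ≤
        (Submodule.map₂ f (Submodule.map₂ (rightAct k A N) X U) F).comap (f n) := by
      rw [Submodule.map₂_le]
      intro a ha x hx
      rw [Submodule.mem_comap, hfg]
      exact Submodule.apply_mem_map₂ _ (Submodule.apply_mem_map₂ _ hn ha) hx
    exact this hy
  have htop : ∀ m : M, m ∈ Submodule.map₂ f ⊤ F := by
    intro m
    have hT' : ∀ n y, D.e * y = y → f n y ∈ Submodule.map₂ f ⊤ F := fun n y hy =>
      Submodule.map₂_le_map₂_left le_top (hT ⊤ ⊤ n y Submodule.mem_top (hmemg y hy))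
    have hm : m ∈ Submodule.span Bᵐᵒᵖ (Set.range φ) := hspan ▸ Submodule.mem_top
    induction hm using Submodule.span_induction with
    | mem m hm =>
      obtain ⟨n, rfl⟩ := hm
      rw [← hφe, ← hfa]
      exact hT' _ _ D.idem
    | zero => exact zero_mem _
    | add a b _ _ ha hb => exact add_mem ha hb
    | smul c m _ hm =>
      have : Submodule.map₂ f ⊤ F ≤
          (Submodule.map₂ f ⊤ F).comap ((rightAct k B M).flip c.unop) := by
        rw [Submodule.map₂_le]
        intro n _ x hx
        have : (rightAct k B M).flip c.unop (f n x) = f n (x * c.unop) := by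
          rw [LinearMap.flip_apply, hfa, hfa, rightAct_apply, MulOpposite.op_mul, mul_smul]
        rw [Submodule.mem_comap, this]
        apply hT'
        rw [← mul_assoc, hFe x hx]
      exact this hm
  refine gkDimModule_le fun V W hV hW => ?_
  obtain ⟨P, -, Q, hQ, hP, -, hWPQ⟩ := Submodule.exists_fg_le_map₂ f hW fun m _ => htop m
  have hWP : W ≤ Submodule.map₂ f P F := hWPQ.trans (Submodule.map₂_le_map₂_right hQ)
  -- `F V` stays inside `eB`, so its elements can be rewritten with coefficients in `A` on the left.
  have hFV : F * V ≤ Submodule.map₂ g ⊤ F := by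
    rw [Submodule.mul_le]
    intro x hx v _
    exact hmemg _ (by rw [← mul_assoc, hFe x hx])
  obtain ⟨U, -, Q', hQ', hU, -, hUQ⟩ := Submodule.exists_fg_le_map₂ g (hFfg.mul hV) hFV
  have hFVU : F * V ≤ Submodule.map₂ g U F := hUQ.trans (Submodule.map₂_le_map₂_right hQ')
  -- Each factor from `V` is moved to the left past `F`, where it becomes a factor from `U` acting
  -- on `N`.
  have key : ∀ n, Submodule.map₂ (rightAct k B M) W (V ^ n) ≤
      Submodule.map₂ f (Submodule.map₂ (rightAct k A N) P (U ^ n)) F := by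
    intro n
    induction n with
    | zero => rwa [pow_zero, pow_zero, map₂_rightAct_one, map₂_rightAct_one]
    | succ n ih =>
      rw [pow_succ, map₂_rightAct_mul, pow_succ, map₂_rightAct_mul]
      refine (Submodule.map₂_le_map₂_left ih).trans ?_
      rw [Submodule.map₂_le]
      intro m hm v hv
      have : Submodule.map₂ f (Submodule.map₂ (rightAct k A N) P (U ^ n)) F ≤
          (Submodule.map₂ f (Submodule.map₂ (rightAct k A N)
            (Submodule.map₂ (rightAct k A N) P (U ^ n)) U) F).comap
              ((rightAct k B M).flip v) := by
        rw [Submodule.map₂_le]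
        intro y hy x hx
        have h : (rightAct k B M).flip v (f y x) = f y (x * v) := by
          rw [LinearMap.flip_apply, hfa, hfa, rightAct_apply, MulOpposite.op_mul, mul_smul]
        rw [Submodule.mem_comap, h]
        exact hT _ _ _ _ hy (hFVU (Submodule.mul_mem_mul hx hv))
      exact this hm
  refine le_trans ?_ (growthDegree_le_gkDimModule hP hU)
  refine limsup_dimLog_le_of_le_mul (Module.finrank k F) fun n _ => ?_
  have hPU := fg_map₂_rightAct_pow hP hU n
  exact (Submodule.finrank_le_of_le_of_fg (key n) (hPU.map₂ f hFfg)).trans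
    (Submodule.finrank_map₂_le f hPU hFfg)

end

end Corner

/-! ### Modules annihilated by an ideal grow no faster than the quotient algebra. -/

section Quotient

variable {k B C M : Type*} [Field k] [Ring B] [Algebra k B] [Ring C] [Algebra k C]
  [AddCommGroup M] [Module k M] [Module Bᵐᵒᵖ M] [IsScalarTower k Bᵐᵒᵖ M]

theorem smul_eq_zero_of_mem_twoSidedIdeal_span {e : B}
    (he : ∀ m : M, MulOpposite.op e • m = 0) {b : B} (hb : b ∈ TwoSidedIdeal.span {e}) (m : M) :
    MulOpposite.op b • m = 0 := by
  induction hb using TwoSidedIdeal.span_induction generalizing m with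
  | mem x h => rw [Set.mem_singleton_iff.1 h, he]
  | zero => simp
  | add x y _ _ hx hy => rw [MulOpposite.op_add, add_smul, hx, hy, add_zero]
  | neg x _ hx => rw [MulOpposite.op_neg, neg_smul, hx, neg_zero]
  | left_absorb a x _ hx => rw [MulOpposite.op_mul, mul_smul, hx]
  | right_absorb b x _ hx => rw [MulOpposite.op_mul, mul_smul, hx, smul_zero]

/-- The action factors through `C`. With `Y` spanned by module generators and `W ⊆ Y U`, one has `W
V ^ n ⊆ Y (U V ^ n)`, and `U V ^ n` maps into the `n`-th power of one fixed finite-dimensional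
subspace of `C`. -/
theorem gkDimModule_le_gkDim_of_quotient [Module.Finite Bᵐᵒᵖ M] (π : B →ₐ[k] C)
    (hπ : Function.Surjective π) (hM : ∀ b, π b = 0 → ∀ m : M, MulOpposite.op b • m = 0) :
    gkDimModule k B M ≤ gkDim k C := by
  -- A linear section of `π` suffices to describe the action of `C`: two lifts of the same element
  -- act alike on `M`.
  obtain ⟨σ, hσ⟩ := π.toLinearMap.exists_rightInverse_of_surjective (LinearMap.range_eq_top.2 hπ)
  have hσ' : ∀ c, π (σ c) = c := fun c => LinearMap.congr_fun hσ c
  set f : M →ₗ[k] C →ₗ[k] M := (rightAct k B M).compl₂ σ with hf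
  have hact : ∀ m b, rightAct k B M m b = f m (π b) := fun m b => by
    rw [hf, LinearMap.compl₂_apply, ← sub_eq_zero, ← map_sub]
    exact hM _ (by rw [map_sub, hσ', sub_self]) m
  obtain ⟨s, hs⟩ := (Module.finite_def.1 ‹Module.Finite Bᵐᵒᵖ M›)
  set Y : Submodule k M := Submodule.span k (s : Set M) with hY
  have hYfg : Y.FG := ⟨s, rfl⟩
  have htop : ∀ m : M, m ∈ Submodule.map₂ (rightAct k B M) Y ⊤ := by
    intro m
    obtain ⟨c, -, rfl⟩ := Submodule.mem_span_finset.1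
      (hs ▸ Submodule.mem_top : m ∈ Submodule.span Bᵐᵒᵖ (s : Set M))
    exact Submodule.sum_mem _ fun x hx => Submodule.apply_mem_map₂ (rightAct k B M)
      (Submodule.subset_span hx) (Submodule.mem_top : (c x).unop ∈ ⊤)
  refine gkDimModule_le fun V W hV hW => ?_
  obtain ⟨Y', hY', U, -, -, hU, hWU⟩ :=
    Submodule.exists_fg_le_map₂ (rightAct k B M) hW fun m _ => htop m
  have hWU' : W ≤ Submodule.map₂ (rightAct k B M) Y U :=
    hWU.trans (Submodule.map₂_le_map₂_left hY')
  set T : Submodule k B := 1 ⊔ (U ⊔ V) with hT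
  have hone : (1 : Submodule k B).FG := by
    rw [Submodule.one_eq_span]
    exact Submodule.fg_span_singleton _
  have hTfg : T.FG := hone.sup (hU.sup hV)
  have hT1 : 1 ≤ T := le_sup_left
  -- The extra factor `U` raises the exponent to `n + 1`, which is at most `2 * n` for `n ≥ 1`; this
  -- is why the growth comparison ignores `n = 0` and why `T ^ 2` appears.
  have hpow : ∀ n, 1 ≤ n → U * V ^ n ≤ (T ^ 2) ^ n := fun n hn => by
    rw [← pow_mul]
    calc U * V ^ n ≤ T * T ^ n := mul_le_mul' (le_sup_left.trans le_sup_right)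
          (pow_le_pow_left' (le_sup_right.trans le_sup_right) n)
      _ = T ^ (n + 1) := (pow_succ' _ _).symm
      _ ≤ T ^ (2 * n) := pow_le_pow_right' hT1 (by omega)
  have hle : Filter.limsup (fun n : ℕ => dimLog n (Module.finrank k
      (((T ^ 2).map π.toLinearMap) ^ n : Submodule k C))) Filter.atTop ≤ gkDim k C :=
    le_iSup₂_of_le (f := fun (V : Submodule k C) (_ : V.FG) =>
      Filter.limsup (fun n : ℕ => dimLog n (Module.finrank k (V ^ n : Submodule k C)))
        Filter.atTop) _ ((hTfg.pow 2).map π.toLinearMap) le_rfl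
  refine le_trans ?_ hle
  refine limsup_dimLog_le_of_le_mul (Module.finrank k Y) fun n hn => ?_
  have hfg := ((hTfg.pow 2).map π.toLinearMap).pow n
  rw [mul_comm]
  refine le_trans (Submodule.finrank_le_of_le_of_fg ?_ (hYfg.map₂ f hfg))
    (Submodule.finrank_map₂_le f hYfg hfg)
  refine (Submodule.map₂_le_map₂_left hWU').trans ?_
  rw [← map₂_rightAct_mul]
  refine (Submodule.map₂_le_map₂_right (hpow n hn)).trans ?_
  rw [Submodule.map₂_le]
  intro m hm b hb
  rw [hact]
  refine Submodule.apply_mem_map₂ _ hm ?_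
  rw [← Submodule.map_pow]
  exact Submodule.mem_map_of_mem hb

end Quotient

/-! ## Gradings by coactions -/

section Coaction

variable {k ι V V' : Type*} [Field k] [AddCommGroup V] [Module k V] [AddCommGroup V']
  [Module k V'] [DecidableEq ι]

/-- Independence is read off from `δ`: an element of `deg i` that is also a sum of elements of other
degrees has `i`-th component both `j x` and 0. The map `j` lets a subspace borrow the coaction of
the space containing it. -/
theorem DirectSum.isInternal_of_coaction (deg : ι → Submodule k V) (j : V →ₗ[k] V')
    (hj : Function.Injective j) (δ : V →ₗ[k] (ι →₀ V'))
    (hδ : ∀ i, ∀ x ∈ deg i, δ x = Finsupp.single i (j x)) (htop : ⨆ i, deg i = ⊤) :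
    DirectSum.IsInternal deg := by
  refine DirectSum.isInternal_submodule_of_iSupIndep_of_iSup_eq_top ?_ htop
  rw [iSupIndep_def]
  intro i
  rw [Submodule.disjoint_def]
  intro x hx hx'
  have h1 : ⨆ l, ⨆ (_ : l ≠ i), deg l ≤ LinearMap.ker (Finsupp.lapply i ∘ₗ δ) := by
    refine iSup₂_le fun l hl y hy => ?_
    simp [hδ l y hy, hl]
  have h2 := h1 hx'
  simp only [LinearMap.mem_ker, LinearMap.comp_apply, hδ i x hx, Finsupp.lapply_apply,
    Finsupp.single_eq_same] at h2
  exact hj (h2.trans (map_zero j).symm)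

/-- The coaction attached to a grading: it sends `x` of degree `i` to `single i x`. -/
def DirectSum.IsInternal.coaction {deg : ι → Submodule k V} (h : DirectSum.IsInternal deg) :
    V →ₗ[k] (ι →₀ V) :=
  DirectSum.toModule k ι (ι →₀ V) (fun i => Finsupp.lsingle i ∘ₗ (deg i).subtype) ∘ₗ
    (LinearEquiv.ofBijective (DirectSum.coeLinearMap deg) h).symm.toLinearMap

theorem DirectSum.IsInternal.coaction_of_mem {deg : ι → Submodule k V}
    (h : DirectSum.IsInternal deg) {i : ι} {x : V} (hx : x ∈ deg i) :
    h.coaction x = Finsupp.single i x := by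
  have : (LinearEquiv.ofBijective (DirectSum.coeLinearMap deg) h).symm x =
      DirectSum.lof k ι (fun i => deg i) i ⟨x, hx⟩ := by
    rw [LinearEquiv.symm_apply_eq]
    exact (DirectSum.coeLinearMap_lof (A := deg) i ⟨x, hx⟩).symm
  simp [DirectSum.IsInternal.coaction, this]

end Coaction

namespace Corner

section

variable {k A B : Type*} [Field k] [Ring A] [Algebra k A] [Ring B] [Algebra k B]

/-- Compatibility of a corner with gradings. -/
structure IsGraded (D : Corner k A B) (𝒜 : ℕ → Submodule k A) (ℬ : ℕ → Submodule k B) :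
    Prop where
  e_mem : D.e ∈ ℬ 0
  ι_mem : ∀ {i a}, a ∈ 𝒜 i → D.ι a ∈ ℬ i
  iSup_eq_top : ⨆ i, 𝒜 i = ⊤
  isInternal : DirectSum.IsInternal ℬ
  mul_mem : ∀ {i j b c}, b ∈ ℬ i → c ∈ ℬ j → b * c ∈ ℬ (i + j)

variable (D : Corner k A B)

/-! ### Restriction to the corner -/

section Fixed

variable (M : Type*) [AddCommGroup M] [Module k M] [Module Bᵐᵒᵖ M] [IsScalarTower k Bᵐᵒᵖ M]

/-- The subspace `M e` of a right module. -/
def fixed : Submodule k M where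
  carrier := {m | MulOpposite.op D.e • m = m}
  add_mem' {a b} ha hb := by
    change _ = _ at ha hb
    change _ = _
    rw [smul_add, ha, hb]
  zero_mem' := smul_zero _
  smul_mem' c m hm := by
    change _ = _ at hm
    change _ = _
    rw [smul_comm, hm]

variable {M}

theorem mem_fixed {m : M} : m ∈ D.fixed M ↔ MulOpposite.op D.e • m = m := Iff.rfl

theorem smul_e_mem_fixed (m : M) : MulOpposite.op D.e • m ∈ D.fixed M := by
  rw [mem_fixed, ← mul_smul, ← MulOpposite.op_mul, D.idem]

theorem ι_smul_mem_fixed (a : A) {m : M} (hm : m ∈ D.fixed M) :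
    MulOpposite.op (D.ι a) • m ∈ D.fixed M := by
  rw [mem_fixed] at hm ⊢
  rw [← mul_smul, ← MulOpposite.op_mul, D.comm, MulOpposite.op_mul, mul_smul, hm]

instance : Module Aᵐᵒᵖ (D.fixed M) where
  smul a m := ⟨MulOpposite.op (D.ι a.unop) • (m : M), D.ι_smul_mem_fixed _ m.2⟩
  one_smul m := Subtype.ext (by
    change MulOpposite.op (D.ι 1) • (m : M) = m
    simp)
  mul_smul a b m := Subtype.ext (by
    change MulOpposite.op (D.ι (b.unop * a.unop)) • (m : M) =
      MulOpposite.op (D.ι a.unop) • MulOpposite.op (D.ι b.unop) • (m : M)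
    rw [map_mul, MulOpposite.op_mul, mul_smul])
  smul_zero a := Subtype.ext (smul_zero (MulOpposite.op (D.ι a.unop)))
  smul_add a m n := Subtype.ext (smul_add (MulOpposite.op (D.ι a.unop)) (m : M) n)
  add_smul a b m := Subtype.ext (by
    change MulOpposite.op (D.ι (a.unop + b.unop)) • (m : M) =
      MulOpposite.op (D.ι a.unop) • (m : M) + MulOpposite.op (D.ι b.unop) • (m : M)
    rw [map_add, MulOpposite.op_add, add_smul])
  zero_smul m := Subtype.ext (by
    change MulOpposite.op (D.ι 0) • (m : M) = 0
    simp)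

theorem coe_smul_fixed (a : A) (m : D.fixed M) :
    ((MulOpposite.op a • m : D.fixed M) : M) = MulOpposite.op (D.ι a) • (m : M) := rfl

instance : IsScalarTower k Aᵐᵒᵖ (D.fixed M) where
  smul_assoc c a m := Subtype.ext (by
    change MulOpposite.op (D.ι (c • a.unop)) • (m : M) = c • MulOpposite.op (D.ι a.unop) • (m : M)
    rw [map_smul, MulOpposite.op_smul, smul_assoc])

/-- Mirror image of `exists_left_generators`: choose generators `x` of the submodule `(Me)B` inside
`Me`, and apply `e` to `m = ∑ x f_x`. Since `x = xe`, the coefficients become `e f_x e`, that is,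
elements of `A`. -/
theorem finite_fixed [IsNoetherian Bᵐᵒᵖ M] : Module.Finite Aᵐᵒᵖ (D.fixed M) := by
  classical
  obtain ⟨s, hs, hspan⟩ := (Submodule.fg_span_iff_fg_span_finset_subset (D.fixed M : Set M)).1
    (IsNoetherian.noetherian (Submodule.span Bᵐᵒᵖ (D.fixed M : Set M)))
  refine ⟨s.attach.image fun x => ⟨x.1, hs x.2⟩, ?_⟩
  rw [eq_top_iff]
  rintro m -
  have hmem : (m : M) ∈ Submodule.span Bᵐᵒᵖ (s : Set M) := by
    rw [← hspan]
    exact Submodule.subset_span m.2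
  obtain ⟨f, -, hf⟩ := Submodule.mem_span_finset.1 hmem
  have : m = ∑ x ∈ s.attach,
      MulOpposite.op (D.θ (f x.1).unop) • (⟨x.1, hs x.2⟩ : D.fixed M) := by
    apply Subtype.ext
    rw [AddSubmonoidClass.coe_finsetSum]
    simp only [coe_smul_fixed]
    rw [Finset.sum_attach s fun x => MulOpposite.op (D.ι (D.θ (f x).unop)) • x,
      ← (D.mem_fixed.1 m.2), ← hf, Finset.smul_sum]
    refine Finset.sum_congr rfl fun x hx => ?_
    have hx' := D.mem_fixed.1 (hs hx)
    obtain ⟨b, hb⟩ : ∃ b, f x = MulOpposite.op b := ⟨_, rfl⟩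
    rw [hb, MulOpposite.unop_op]
    calc MulOpposite.op D.e • MulOpposite.op b • x
        = MulOpposite.op D.e • MulOpposite.op b • MulOpposite.op D.e • x := by rw [hx']
      _ = MulOpposite.op (D.e * b * D.e) • x := by
        rw [← mul_smul, ← mul_smul, ← MulOpposite.op_mul, ← MulOpposite.op_mul, mul_assoc]
      _ = MulOpposite.op (D.ι (D.θ b)) • MulOpposite.op D.e • x := by
        rw [D.compress, D.comm, MulOpposite.op_mul, mul_smul]
      _ = MulOpposite.op (D.ι (D.θ b)) • x := by rw [hx']
  rw [this]
  refine Submodule.sum_mem _ fun x _ => Submodule.smul_mem _ _ (Submodule.subset_span ?_)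
  simp

end Fixed

/-- Functoriality of `M ↦ M e`. -/
def fixedMap {M M' : Type*} [AddCommGroup M] [Module k M] [Module Bᵐᵒᵖ M]
    [IsScalarTower k Bᵐᵒᵖ M] [AddCommGroup M'] [Module k M'] [Module Bᵐᵒᵖ M']
    [IsScalarTower k Bᵐᵒᵖ M'] (f : M →ₗ[Bᵐᵒᵖ] M') : D.fixed M →ₗ[Aᵐᵒᵖ] D.fixed M' where
  toFun m := ⟨f m, by rw [mem_fixed, ← map_smul, D.mem_fixed.1 m.2]⟩
  map_add' m n := Subtype.ext (map_add f (m : M) n)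
  map_smul' a m := Subtype.ext (map_smul f (MulOpposite.op (D.ι a.unop)) (m : M))

theorem coe_fixedMap {M M' : Type*} [AddCommGroup M] [Module k M] [Module Bᵐᵒᵖ M]
    [IsScalarTower k Bᵐᵒᵖ M] [AddCommGroup M'] [Module k M'] [Module Bᵐᵒᵖ M']
    [IsScalarTower k Bᵐᵒᵖ M'] (f : M →ₗ[Bᵐᵒᵖ] M') (m : D.fixed M) :
    (D.fixedMap f m : M') = f m := rfl

/-! ### Induction from the corner -/

section Induced

variable (N : Type*) [AddCommGroup N] [Module k N] [Module Aᵐᵒᵖ N]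

/-- The relations defining `N ⊗_A e B` as a quotient of `B ⊗_k N`. -/
def inducedRel : Submodule Bᵐᵒᵖ (B ⊗[k] N) :=
  Submodule.span Bᵐᵒᵖ {z | ∃ (a : A) (b : B) (n : N),
    z = (D.ι a * D.e * b) ⊗ₜ[k] n - b ⊗ₜ[k] (MulOpposite.op a • n)}

/-- The right `B`-module `N ⊗_A e B` induced by a right `A`-module `N`. -/
abbrev Induced := (B ⊗[k] N) ⧸ D.inducedRel N

/-- The class of `n ⊗ e b` in `N ⊗_A e B`. -/
def inducedMk : B →ₗ[k] N →ₗ[k] D.Induced N :=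
  (TensorProduct.mk k B N).compr₂ ((D.inducedRel N).mkQ.restrictScalars k)

variable {N}

theorem inducedMk_apply (b : B) (n : N) :
    D.inducedMk N b n = (D.inducedRel N).mkQ (b ⊗ₜ n) := rfl

theorem smul_inducedMk (b c : B) (n : N) :
    MulOpposite.op c • D.inducedMk N b n = D.inducedMk N (b * c) n := by
  rw [inducedMk_apply, inducedMk_apply, ← map_smul, TensorProduct.smul_tmul', op_smul_eq_mul]

theorem inducedMk_ι_mul (a : A) (b : B) (n : N) :
    D.inducedMk N (D.ι a * D.e * b) n = D.inducedMk N b (MulOpposite.op a • n) := by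
  rw [inducedMk_apply, inducedMk_apply, ← sub_eq_zero, ← map_sub, Submodule.mkQ_apply,
    Submodule.Quotient.mk_eq_zero]
  exact Submodule.subset_span ⟨a, b, n, rfl⟩

/-- The case `a = 1` of the relations. It is what allows all of `B`, rather than `eB`, as the tensor
factor. -/
theorem inducedMk_e_mul (b : B) (n : N) : D.inducedMk N (D.e * b) n = D.inducedMk N b n := by
  simpa using D.inducedMk_ι_mul 1 b n

theorem inducedMk_e (n : N) : D.inducedMk N D.e n = D.inducedMk N 1 n := by
  simpa using D.inducedMk_e_mul 1 n

@[elab_as_elim]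
theorem induced_induction {p : D.Induced N → Prop} (z : D.Induced N) (h0 : p 0)
    (hmk : ∀ b n, p (D.inducedMk N b n)) (hadd : ∀ x y, p x → p y → p (x + y)) : p z := by
  obtain ⟨y, rfl⟩ := (D.inducedRel N).mkQ_surjective z
  induction y with
  | zero => simpa using h0
  | tmul b n => exact hmk b n
  | add x y hx hy => rw [map_add]; exact hadd _ _ hx hy

theorem induced_hom_ext {M : Type*} [AddCommGroup M] [Module Bᵐᵒᵖ M]
    {f g : D.Induced N →ₗ[Bᵐᵒᵖ] M}
    (h : ∀ b n, f (D.inducedMk N b n) = g (D.inducedMk N b n)) : f = g :=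
  LinearMap.ext fun z => by
    induction z using D.induced_induction with
    | h0 => rw [map_zero, map_zero]
    | hadd x y hx hy => rw [map_add, map_add, hx, hy]
    | hmk b n => exact h b n

theorem finite_induced [Module.Finite Aᵐᵒᵖ N] : Module.Finite Bᵐᵒᵖ (D.Induced N) := by
  classical
  obtain ⟨s, hs⟩ := Module.finite_def.1 ‹Module.Finite Aᵐᵒᵖ N›
  refine ⟨s.image (D.inducedMk N 1), ?_⟩
  rw [eq_top_iff]
  rintro z -
  induction z using D.induced_induction with
  | h0 => exact zero_mem _
  | hadd x y hx hy => exact add_mem hx hy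
  | hmk b n =>
    obtain ⟨f, -, hf⟩ := Submodule.mem_span_finset.1
      (hs ▸ Submodule.mem_top : n ∈ Submodule.span Aᵐᵒᵖ (s : Set N))
    rw [← hf, map_sum]
    refine Submodule.sum_mem _ fun x hx => ?_
    obtain ⟨a, ha⟩ : ∃ a, f x = MulOpposite.op a := ⟨_, rfl⟩
    rw [ha, ← inducedMk_ι_mul, ← one_mul (D.ι a * D.e * b), ← smul_inducedMk]
    refine Submodule.smul_mem _ _ (Submodule.subset_span ?_)
    rw [Finset.coe_image]
    exact Set.mem_image_of_mem _ hx

/-- Because `(n ⊗ eb)e = n ⊗ ebe = n θ(b) ⊗ e`, the corner of the induced module is the image of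
`N`. -/
theorem exists_smul_e_eq (z : D.Induced N) : ∃ n, MulOpposite.op D.e • z = D.inducedMk N 1 n := by
  induction z using D.induced_induction with
  | h0 => exact ⟨0, by simp⟩
  | hmk b n =>
    refine ⟨MulOpposite.op (D.θ b) • n, ?_⟩
    rw [smul_inducedMk, ← inducedMk_e_mul, ← mul_assoc, D.compress, ← inducedMk_ι_mul, mul_one]
  | hadd x y hx hy =>
    obtain ⟨m, hm⟩ := hx
    obtain ⟨n, hn⟩ := hy
    exact ⟨m + n, by rw [smul_add, hm, hn, map_add]⟩

theorem span_range_inducedMk_one :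
    Submodule.span Bᵐᵒᵖ (Set.range (D.inducedMk N 1)) = ⊤ := by
  rw [eq_top_iff]
  rintro z -
  induction z using D.induced_induction with
  | h0 => exact zero_mem _
  | hadd x y hx hy => exact add_mem hx hy
  | hmk b n =>
    rw [← one_mul b, ← smul_inducedMk]
    exact Submodule.smul_mem _ _ (Submodule.subset_span ⟨n, rfl⟩)

theorem inducedMk_one_smul (a : A) (n : N) :
    D.inducedMk N 1 (MulOpposite.op a • n) = MulOpposite.op (D.ι a) • D.inducedMk N 1 n := by
  rw [smul_inducedMk, one_mul, ← inducedMk_ι_mul, mul_one, D.comm, inducedMk_e_mul]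

theorem e_smul_inducedMk_one (n : N) :
    MulOpposite.op D.e • D.inducedMk N 1 n = D.inducedMk N 1 n := by
  rw [smul_inducedMk, one_mul, inducedMk_e]

section Lift

variable {V : Type*} [AddCommGroup V] [Module k V]

theorem lift_eq_zero_of_mem_inducedRel (g : B →ₗ[k] N →ₗ[k] V)
    (hg : ∀ a b n, g (D.ι a * D.e * b) n = g b (MulOpposite.op a • n)) {z : B ⊗[k] N}
    (hz : z ∈ D.inducedRel N) : TensorProduct.lift g z = 0 := by
  -- The relations are generated over `B` but `g` is only `k`-linear, so the vanishing has to be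
  -- proved for all translates of `z` at once.
  have key : ∀ c : Bᵐᵒᵖ, TensorProduct.lift g (c • z) = 0 := by
    induction hz using Submodule.span_induction with
    | mem z hz =>
      obtain ⟨a, b, n, rfl⟩ := hz
      intro c
      obtain ⟨c, rfl⟩ := MulOpposite.op_surjective c
      rw [smul_sub, TensorProduct.smul_tmul', TensorProduct.smul_tmul', op_smul_eq_mul,
        op_smul_eq_mul, map_sub, TensorProduct.lift.tmul, TensorProduct.lift.tmul, mul_assoc, hg,
        sub_self]
    | zero => simp
    | add x y _ _ hx hy => intro c; rw [smul_add, map_add, hx, hy, add_zero]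
    | smul b x _ hx => intro c; rw [← mul_smul, hx]
  simpa using key 1

/-- The linear map on `N ⊗_A e B` attached to a balanced bilinear map. -/
def inducedLift (g : B →ₗ[k] N →ₗ[k] V)
    (hg : ∀ a b n, g (D.ι a * D.e * b) n = g b (MulOpposite.op a • n)) :
    D.Induced N →ₗ[k] V :=
  ((D.inducedRel N).restrictScalars k).liftQ (TensorProduct.lift g)
    fun _ hz => D.lift_eq_zero_of_mem_inducedRel g hg hz

theorem inducedLift_mk (g : B →ₗ[k] N →ₗ[k] V)
    (hg : ∀ a b n, g (D.ι a * D.e * b) n = g b (MulOpposite.op a • n)) (b : B) (n : N) :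
    D.inducedLift g hg (D.inducedMk N b n) = g b n :=
  TensorProduct.lift.tmul b n

end Lift

section Hom

variable {M : Type*} [AddCommGroup M] [Module k M] [Module Bᵐᵒᵖ M] [IsScalarTower k Bᵐᵒᵖ M]

theorem rightAct_comp_balanced (g : N →ₗ[k] M)
    (hg : ∀ a n, g (MulOpposite.op a • n) = MulOpposite.op (D.ι a * D.e) • g n) (a : A) (b : B)
    (n : N) : (rightAct k B M ∘ₗ g).flip (D.ι a * D.e * b) n =
      (rightAct k B M ∘ₗ g).flip b (MulOpposite.op a • n) := by
  simp only [LinearMap.flip_apply, LinearMap.comp_apply, rightAct_apply, hg]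
  rw [MulOpposite.op_mul, mul_smul]

/-- The module homomorphism `N ⊗_A e B → M` attached to an `A`-linear map `N → M e`. -/
def inducedHom (g : N →ₗ[k] M)
    (hg : ∀ a n, g (MulOpposite.op a • n) = MulOpposite.op (D.ι a * D.e) • g n) :
    D.Induced N →ₗ[Bᵐᵒᵖ] M where
  toFun := D.inducedLift ((rightAct k B M ∘ₗ g).flip) (D.rightAct_comp_balanced g hg)
  map_add' := map_add _
  map_smul' c z := by
    induction z using D.induced_induction with
    | h0 => simp
    | hmk b n =>
      obtain ⟨c, rfl⟩ := MulOpposite.op_surjective c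
      rw [smul_inducedMk, inducedLift_mk, inducedLift_mk]
      simp [mul_smul]
    | hadd x y hx hy => simp only [smul_add, map_add, hx, hy]

theorem inducedHom_mk (g : N →ₗ[k] M)
    (hg : ∀ a n, g (MulOpposite.op a • n) = MulOpposite.op (D.ι a * D.e) • g n) (b : B) (n : N) :
    D.inducedHom g hg (D.inducedMk N b n) = MulOpposite.op b • g n :=
  D.inducedLift_mk _ (D.rightAct_comp_balanced g hg) b n

end Hom

variable [IsScalarTower k Aᵐᵒᵖ N]

/-- Functoriality of `N ↦ N ⊗_A e B`. -/
def inducedMap {N' : Type*} [AddCommGroup N'] [Module k N'] [Module Aᵐᵒᵖ N']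
    [IsScalarTower k Aᵐᵒᵖ N'] (f : N →ₗ[Aᵐᵒᵖ] N') : D.Induced N →ₗ[Bᵐᵒᵖ] D.Induced N' :=
  D.inducedHom (D.inducedMk N' 1 ∘ₗ f.restrictScalars k) fun a n => by
    simp only [LinearMap.comp_apply, LinearMap.restrictScalars_apply, map_smul]
    rw [← inducedMk_ι_mul, smul_inducedMk, mul_one, one_mul]

theorem inducedMap_mk {N' : Type*} [AddCommGroup N'] [Module k N'] [Module Aᵐᵒᵖ N']
    [IsScalarTower k Aᵐᵒᵖ N'] (f : N →ₗ[Aᵐᵒᵖ] N') (b : B) (n : N) :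
    D.inducedMap f (D.inducedMk N b n) = D.inducedMk N' b (f n) := by
  refine (D.inducedHom_mk _ _ b n).trans ?_
  rw [LinearMap.comp_apply, LinearMap.restrictScalars_apply, smul_inducedMk, one_mul]

theorem inducedMap_id : D.inducedMap (LinearMap.id : N →ₗ[Aᵐᵒᵖ] N) = LinearMap.id :=
  D.induced_hom_ext fun b n => D.inducedMap_mk _ b n

theorem inducedMap_comp {N' N'' : Type*} [AddCommGroup N'] [Module k N'] [Module Aᵐᵒᵖ N']
    [IsScalarTower k Aᵐᵒᵖ N'] [AddCommGroup N''] [Module k N''] [Module Aᵐᵒᵖ N'']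
    [IsScalarTower k Aᵐᵒᵖ N''] (f : N →ₗ[Aᵐᵒᵖ] N') (g : N' →ₗ[Aᵐᵒᵖ] N'') :
    D.inducedMap (g ∘ₗ f) = D.inducedMap g ∘ₗ D.inducedMap f :=
  D.induced_hom_ext fun b n => by
    simp only [LinearMap.comp_apply, inducedMap_mk]

/-- The unit `N → (N ⊗_A e B) e`. -/
def unit (N : Type*) [AddCommGroup N] [Module k N] [Module Aᵐᵒᵖ N] [IsScalarTower k Aᵐᵒᵖ N] :
    N →ₗ[Aᵐᵒᵖ] D.fixed (D.Induced N) where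
  toFun n := ⟨D.inducedMk N 1 n, by rw [mem_fixed, smul_inducedMk, one_mul, inducedMk_e]⟩
  map_add' m n := Subtype.ext (map_add _ _ _)
  map_smul' a n := by
    obtain ⟨a, rfl⟩ := MulOpposite.op_surjective a
    apply Subtype.ext
    rw [RingHom.id_apply, coe_smul_fixed]
    change D.inducedMk N 1 (MulOpposite.op a • n) =
      MulOpposite.op (D.ι a) • D.inducedMk N 1 n
    rw [smul_inducedMk, one_mul, ← inducedMk_ι_mul, mul_one,
      D.comm, inducedMk_e_mul]

theorem coe_unit (n : N) : (D.unit N n : D.Induced N) = D.inducedMk N 1 n := rfl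

theorem unit_injective : Function.Injective (D.unit N) := by
  -- The retraction is `n ⊗ eb ↦ n θ(b)`; it is balanced by `θ_ι_mul` and splits the unit because `θ
  -- 1 = 1`.
  set r : D.Induced N →ₗ[k] N := D.inducedLift ((rightAct k A N).flip ∘ₗ D.θ) fun a b n => by
    simp only [LinearMap.comp_apply, LinearMap.flip_apply, rightAct_apply, θ_ι_mul]
    rw [MulOpposite.op_mul, mul_smul]
  have h : Function.LeftInverse (fun z : D.fixed (D.Induced N) => r z) (D.unit N) := fun n => by
    change r (D.inducedMk N 1 n) = n
    rw [inducedLift_mk]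
    simp [θ_one]
  exact h.injective

theorem unit_surjective : Function.Surjective (D.unit N) := fun z => by
  obtain ⟨n, hn⟩ := D.exists_smul_e_eq z.1
  exact ⟨n, Subtype.ext (by rw [coe_unit, ← hn, D.mem_fixed.1 z.2])⟩

end Induced

/-- The counit `M e ⊗_A e B → M`. -/
def counit (M : Type*) [AddCommGroup M] [Module k M] [Module Bᵐᵒᵖ M] [IsScalarTower k Bᵐᵒᵖ M] :
    D.Induced (D.fixed M) →ₗ[Bᵐᵒᵖ] M :=
  D.inducedHom (D.fixed M).subtype fun a n => by
    rw [Submodule.subtype_apply, Submodule.subtype_apply, coe_smul_fixed, D.comm,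
      MulOpposite.op_mul, mul_smul, D.mem_fixed.1 n.2]

theorem counit_mk {M : Type*} [AddCommGroup M] [Module k M] [Module Bᵐᵒᵖ M]
    [IsScalarTower k Bᵐᵒᵖ M] (b : B) (m : D.fixed M) :
    D.counit M (D.inducedMk _ b m) = MulOpposite.op b • (m : M) :=
  D.inducedHom_mk _ _ b m

theorem counit_naturality {M M' : Type*} [AddCommGroup M] [Module k M] [Module Bᵐᵒᵖ M]
    [IsScalarTower k Bᵐᵒᵖ M] [AddCommGroup M'] [Module k M'] [Module Bᵐᵒᵖ M']
    [IsScalarTower k Bᵐᵒᵖ M'] (f : M →ₗ[Bᵐᵒᵖ] M') :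
    D.counit M' ∘ₗ D.inducedMap (D.fixedMap f) = f ∘ₗ D.counit M :=
  D.induced_hom_ext fun b m => by
    simp only [LinearMap.comp_apply, inducedMap_mk, counit_mk, coe_fixedMap, map_smul]

end

end Corner

/-! ## Graded modules over a corner -/

theorem Submodule.iSup_eq_top_of_surjective {k V V' ι : Type*} [Field k] [AddCommGroup V]
    [Module k V] [AddCommGroup V'] [Module k V'] {deg : ι → Submodule k V}
    {deg' : ι → Submodule k V'} (p : V →ₗ[k] V') (hp : Function.Surjective p)
    (h : ∀ i, ∀ x ∈ deg i, p x ∈ deg' i) (htop : ⨆ i, deg i = ⊤) : ⨆ i, deg' i = ⊤ := by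
  rw [eq_top_iff, ← LinearMap.range_eq_top.2 hp, LinearMap.range_eq_map, ← htop,
    Submodule.map_iSup]
  exact iSup_mono fun i => Submodule.map_le_iff_le_comap.2 (h i)

/-- The convolution of a bilinear map. -/
def Finsupp.convolution {k X Y Z : Type*} [Field k] [AddCommGroup X] [Module k X]
    [AddCommGroup Y] [Module k Y] [AddCommGroup Z] [Module k Z] (f : X →ₗ[k] Y →ₗ[k] Z) :
    (ℕ →₀ X) →ₗ[k] (ℤ →₀ Y) →ₗ[k] (ℤ →₀ Z) :=
  Finsupp.lsum k fun i => (Finsupp.lsum k fun l =>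
    (f.compr₂ (Finsupp.lsingle (l + (i : ℤ)))).flip).flip

theorem Finsupp.convolution_single {k X Y Z : Type*} [Field k] [AddCommGroup X] [Module k X]
    [AddCommGroup Y] [Module k Y] [AddCommGroup Z] [Module k Z] (f : X →ₗ[k] Y →ₗ[k] Z)
    (i : ℕ) (l : ℤ) (x : X) (y : Y) :
    Finsupp.convolution f (Finsupp.single i x) (Finsupp.single l y) =
      Finsupp.single (l + i) (f x y) := by
  simp [Finsupp.convolution]

namespace GrMod

variable {k B : Type u} [Field k] [Ring B] [Algebra k B] {ℬ : ℕ → Submodule k B}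

/-- The linear map underlying a morphism of graded modules. -/
def lin {M N : GrMod ℬ} (f : M ⟶ N) : M.carrier →ₗ[Bᵐᵒᵖ] N.carrier := Hom.toLinearMap f

theorem lin_mem_deg {M N : GrMod ℬ} (f : M ⟶ N) {j : ℤ} {m : M.carrier} (hm : m ∈ M.deg j) :
    lin f m ∈ N.deg j := Hom.map_deg f j m hm

theorem hom_ext {M N : GrMod ℬ} {f g : M ⟶ N} (h : ∀ m, lin f m = lin g m) : f = g :=
  Hom.ext (LinearMap.ext h)

/-- Constructor for morphisms of graded modules. -/
def ofLin {M N : GrMod ℬ} (f : M.carrier →ₗ[Bᵐᵒᵖ] N.carrier)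
    (hf : ∀ j, ∀ m ∈ M.deg j, f m ∈ N.deg j) : M ⟶ N := (⟨f, hf⟩ : Hom M N)

/-- The image of a morphism of graded modules. -/
def image {M N : GrMod ℬ} (f : M ⟶ N) : GrMod ℬ where
  carrier := LinearMap.range (lin f)
  finite := Module.Finite.range (lin f)
  deg j := (N.deg j).comap ((LinearMap.range (lin f)).subtype.restrictScalars k)
  isInternal := DirectSum.isInternal_of_coaction _
    ((LinearMap.range (lin f)).subtype.restrictScalars k) Subtype.val_injective
    (N.isInternal.coaction ∘ₗ (LinearMap.range (lin f)).subtype.restrictScalars k)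
    (fun _ _ hx => N.isInternal.coaction_of_mem hx)
    (Submodule.iSup_eq_top_of_surjective ((lin f).rangeRestrict.restrictScalars k)
      (lin f).surjective_rangeRestrict (fun _ _ hx => lin_mem_deg f hx)
      M.isInternal.submodule_iSup_eq_top)
  smul_mem i j b m hb hm := N.smul_mem i j b m.1 hb hm

/-- The projection to the image. -/
def toImage {M N : GrMod ℬ} (f : M ⟶ N) : M ⟶ image f :=
  ofLin (N := image f) (lin f).rangeRestrict fun _ _ hm => lin_mem_deg f hm

/-- The inclusion of the image. -/
def imageIncl {M N : GrMod ℬ} (f : M ⟶ N) : image f ⟶ N :=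
  ofLin (M := image f) (LinearMap.range (lin f)).subtype fun _ _ hm => hm

theorem toImage_comp_imageIncl {M N : GrMod ℬ} (f : M ⟶ N) : toImage f ≫ imageIncl f = f := rfl

end GrMod

namespace Corner

open GrMod

variable {k A B : Type u} [Field k] [Ring A] [Algebra k A] [Ring B] [Algebra k B]
variable {D : Corner k A B} {𝒜 : ℕ → Submodule k A} {ℬ : ℕ → Submodule k B}

namespace IsGraded

variable (hD : D.IsGraded 𝒜 ℬ)
include hD

section Fixed

variable [IsNoetherianRing Bᵐᵒᵖ]

/-- The graded module `M e`. -/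
def fixedObj (M : GrMod ℬ) : GrMod 𝒜 where
  carrier := D.fixed M.carrier
  finite := D.finite_fixed
  deg j := (M.deg j).comap (D.fixed M.carrier).subtype
  isInternal := DirectSum.isInternal_of_coaction _ (D.fixed M.carrier).subtype
    Subtype.val_injective (M.isInternal.coaction ∘ₗ (D.fixed M.carrier).subtype)
    (fun i x hx => M.isInternal.coaction_of_mem hx)
    -- The projection `m ↦ me` onto `Me` preserves degrees since `e` has degree 0, so homogeneous
    -- elements span `Me`.
    (Submodule.iSup_eq_top_of_surjective
      (((rightAct k B M.carrier).flip D.e).codRestrict _ D.smul_e_mem_fixed)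
      (fun m => ⟨m, Subtype.ext (D.mem_fixed.1 m.2)⟩)
      (fun i x hx => by simpa using! M.smul_mem 0 i D.e x hD.e_mem hx)
      M.isInternal.submodule_iSup_eq_top)
  smul_mem i j a m ha hm := M.smul_mem i j (D.ι a) m.1 (hD.ι_mem ha) hm

/-- The functor `M ↦ M e` on graded modules. -/
def fixedFunctor : GrMod ℬ ⥤ GrMod 𝒜 where
  obj M := hD.fixedObj M
  map f := ofLin (M := hD.fixedObj _) (N := hD.fixedObj _) (D.fixedMap (lin f))
    fun _ _ hm => lin_mem_deg f hm

end Fixed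

section Induced

/-- The degree `j` part of `N ⊗_A e B`. -/
def inducedDeg (_ : D.IsGraded 𝒜 ℬ) (N : GrMod 𝒜) (j : ℤ) : Submodule k (D.Induced N.carrier) :=
  ⨆ i : ℕ, Submodule.map₂ (D.inducedMk N.carrier) (ℬ i) (N.deg (j - i))

theorem inducedMk_mem_inducedDeg (N : GrMod 𝒜) {i : ℕ} {l : ℤ} {b : B} {n : N.carrier}
    (hb : b ∈ ℬ i) (hn : n ∈ N.deg l) : D.inducedMk N.carrier b n ∈ hD.inducedDeg N (l + i) := by
  refine Submodule.mem_iSup_of_mem i (Submodule.apply_mem_map₂ _ hb ?_)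
  rwa [add_sub_cancel_right]

theorem inducedDeg_le (N : GrMod 𝒜) {j : ℤ} {P : Submodule k (D.Induced N.carrier)}
    (h : ∀ (i : ℕ) (l : ℤ) (b : B) (n : N.carrier), l + i = j → b ∈ ℬ i → n ∈ N.deg l →
      D.inducedMk N.carrier b n ∈ P) : hD.inducedDeg N j ≤ P :=
  iSup_le fun i => Submodule.map₂_le.2 fun b hb n hn => h i (j - i) b n (by ring) hb hn

/-- The bilinear map underlying the coaction of `N ⊗_A e B`. -/
def inducedCoactionAux (N : GrMod 𝒜) : B →ₗ[k] N.carrier →ₗ[k] (ℤ →₀ D.Induced N.carrier) :=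
  (Finsupp.convolution (D.inducedMk N.carrier)).compl₁₂ hD.isInternal.coaction
    N.isInternal.coaction

theorem inducedCoactionAux_of_mem (N : GrMod 𝒜) {i : ℕ} {l : ℤ} {b : B} {n : N.carrier}
    (hb : b ∈ ℬ i) (hn : n ∈ N.deg l) :
    hD.inducedCoactionAux N b n = Finsupp.single (l + i) (D.inducedMk N.carrier b n) := by
  rw [inducedCoactionAux, LinearMap.compl₁₂_apply, hD.isInternal.coaction_of_mem hb,
    N.isInternal.coaction_of_mem hn, Finsupp.convolution_single]

/-- By additivity in each variable it suffices to treat homogeneous elements. Both sides then sit in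
the same total degree, `e` contributing 0, and agree by the tensor relation. -/
theorem inducedCoactionAux_balanced (N : GrMod 𝒜) (a : A) (b : B) (n : N.carrier) :
    hD.inducedCoactionAux N (D.ι a * D.e * b) n =
      hD.inducedCoactionAux N b (MulOpposite.op a • n) := by
  have ha : a ∈ ⨆ i, 𝒜 i := hD.iSup_eq_top ▸ Submodule.mem_top
  have hb : b ∈ ⨆ i, ℬ i := hD.isInternal.submodule_iSup_eq_top ▸ Submodule.mem_top
  have hn : n ∈ ⨆ i, N.deg i := N.isInternal.submodule_iSup_eq_top ▸ Submodule.mem_top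
  induction ha using Submodule.iSup_induction' with
  | zero => simp
  | add x y _ _ hx hy =>
    rw [map_add, add_mul, add_mul, map_add, LinearMap.add_apply, hx, hy, MulOpposite.op_add,
      add_smul, map_add]
  | mem i a ha =>
    induction hb using Submodule.iSup_induction' with
    | zero => simp
    | add x y _ _ hx hy => rw [mul_add, map_add, LinearMap.add_apply, hx, hy, map_add,
        LinearMap.add_apply]
    | mem p b hb =>
      induction hn using Submodule.iSup_induction' with
      | zero => simp
      | add x y _ _ hx hy => rw [map_add, hx, hy, smul_add, map_add]
      | mem l n hn =>
        rw [hD.inducedCoactionAux_of_mem N (hD.mul_mem (hD.mul_mem (hD.ι_mem ha) hD.e_mem) hb) hn,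
          hD.inducedCoactionAux_of_mem N hb (N.smul_mem i l a n ha hn), D.inducedMk_ι_mul]
        congr 1
        push_cast
        ring

/-- The graded module `N ⊗_A e B`. -/
def inducedObj (N : GrMod 𝒜) : GrMod ℬ where
  carrier := D.Induced N.carrier
  finite := D.finite_induced
  deg := hD.inducedDeg N
  isInternal := by
    refine DirectSum.isInternal_of_coaction _ LinearMap.id Function.injective_id
      (D.inducedLift _ (hD.inducedCoactionAux_balanced N)) (fun j x hx => ?_) ?_
    · refine (hD.inducedDeg_le N (P := LinearMap.eqLocus
        (D.inducedLift _ (hD.inducedCoactionAux_balanced N)) (Finsupp.lsingle j)) ?_) hx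
      rintro i l b n rfl hb hn
      change D.inducedLift _ _ _ = Finsupp.single _ _
      rw [inducedLift_mk, hD.inducedCoactionAux_of_mem N hb hn]
    · rw [eq_top_iff]
      rintro z -
      induction z using D.induced_induction with
      | h0 => exact zero_mem _
      | hadd x y hx hy => exact add_mem hx hy
      | hmk b n =>
        have hb : b ∈ ⨆ i, ℬ i := hD.isInternal.submodule_iSup_eq_top ▸ Submodule.mem_top
        have hn : n ∈ ⨆ i, N.deg i := N.isInternal.submodule_iSup_eq_top ▸ Submodule.mem_top
        have h := Submodule.apply_mem_map₂ (D.inducedMk N.carrier) hb hn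
        rw [Submodule.map₂_iSup_left] at h
        refine (iSup_le fun i => ?_ : _ ≤ ⨆ j, hD.inducedDeg N j) h
        rw [Submodule.map₂_iSup_right]
        refine iSup_le fun l => Submodule.map₂_le.2 fun b hb n hn => ?_
        exact Submodule.mem_iSup_of_mem _ (hD.inducedMk_mem_inducedDeg N hb hn)
  smul_mem i j c z hc hz := by
    refine (hD.inducedDeg_le N (P := (hD.inducedDeg N (j + i)).comap
      ((rightAct k B (D.Induced N.carrier)).flip c)) ?_) hz
    rintro p l b n rfl hb hn
    rw [Submodule.mem_comap, LinearMap.flip_apply, rightAct_apply, smul_inducedMk]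
    have := hD.inducedMk_mem_inducedDeg N (hD.mul_mem hb hc) hn
    rwa [Nat.cast_add, ← add_assoc] at this

/-- The functor `N ↦ N ⊗_A e B` on graded modules. -/
def inducedFunctor : GrMod 𝒜 ⥤ GrMod ℬ where
  obj N := hD.inducedObj N
  map {N N'} f := ofLin (M := hD.inducedObj N) (N := hD.inducedObj N') (D.inducedMap (lin f))
    fun j z hz => by
      refine (hD.inducedDeg_le N (P := (hD.inducedDeg N' j).comap
        ((D.inducedMap (lin f)).restrictScalars k)) ?_) hz
      rintro i l b n rfl hb hn
      rw [Submodule.mem_comap, LinearMap.restrictScalars_apply, inducedMap_mk]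
      exact hD.inducedMk_mem_inducedDeg N' hb (lin_mem_deg f hn)
  map_id _ := Hom.ext D.inducedMap_id
  map_comp f g := Hom.ext (D.inducedMap_comp (lin f) (lin g))

end Induced

/-! ### Graded unit and counit. -/

section Adjunction

variable [IsNoetherianRing Bᵐᵒᵖ]

/-- The unit of the adjunction between `N ↦ N ⊗_A e B` and `M ↦ M e`. -/
def unitNatTrans : 𝟭 (GrMod 𝒜) ⟶ hD.inducedFunctor ⋙ hD.fixedFunctor where
  app N := ofLin (M := N) (N := hD.fixedObj (hD.inducedObj N)) (D.unit N.carrier) fun j n hn => by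
    have := hD.inducedMk_mem_inducedDeg N hD.e_mem hn
    rw [inducedMk_e] at this
    simpa using! this
  naturality N N' f := hom_ext fun n => Subtype.ext (D.inducedMap_mk (lin f) 1 n).symm

/-- The counit of the adjunction between `N ↦ N ⊗_A e B` and `M ↦ M e`. -/
def counitNatTrans : hD.fixedFunctor ⋙ hD.inducedFunctor ⟶ 𝟭 (GrMod ℬ) where
  app M := ofLin (M := hD.inducedObj (hD.fixedObj M)) (N := M) (D.counit M.carrier)
    fun j z hz => by
      refine (hD.inducedDeg_le (hD.fixedObj M) (P := (M.deg j).comap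
        ((D.counit M.carrier).restrictScalars k)) ?_) hz
      rintro i l b (n : D.fixed M.carrier) rfl hb hn
      change D.counit M.carrier (D.inducedMk (D.fixed M.carrier) b n) ∈ M.deg _
      rw [counit_mk]
      exact M.smul_mem i l b n.1 hb hn
  naturality _ _ f := Hom.ext (D.counit_naturality (lin f))

end Adjunction

end IsGraded
end Corner

/-! ## The quotient categories of a corner -/

theorem Submodule.span_range_eq_top_of_le {k R M P : Type*} [Field k] [Ring R] [AddCommGroup M]
    [Module R M] {K : Submodule R M} (φ : P → K)
    (h : K ≤ Submodule.span R (Set.range fun p => (φ p : M))) :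
    Submodule.span R (Set.range φ) = ⊤ := by
  apply Submodule.map_injective_of_injective K.subtype_injective
  rw [Submodule.map_span, ← Set.range_comp, Submodule.map_top, Submodule.range_subtype]
  refine le_antisymm ?_ h
  rw [Submodule.span_le]
  rintro _ ⟨p, rfl⟩
  exact (φ p).2

namespace Corner

open GrMod

/-! ### Kernels and cokernels under induction and restriction. -/

section

variable {k A B : Type*} [Field k] [Ring A] [Algebra k A] [Ring B] [Algebra k B]
variable (D : Corner k A B)
variable {N N' : Type*} [AddCommGroup N] [Module k N] [Module Aᵐᵒᵖ N] [IsScalarTower k Aᵐᵒᵖ N]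
  [AddCommGroup N'] [Module k N'] [Module Aᵐᵒᵖ N'] [IsScalarTower k Aᵐᵒᵖ N']
variable {M M' : Type*} [AddCommGroup M] [Module k M] [Module Bᵐᵒᵖ M] [IsScalarTower k Bᵐᵒᵖ M]
  [AddCommGroup M'] [Module k M'] [Module Bᵐᵒᵖ M'] [IsScalarTower k Bᵐᵒᵖ M']

/-- Right exactness of `N ↦ N ⊗_A e B`. -/
theorem ker_inducedMap_le (f : N →ₗ[Aᵐᵒᵖ] N') (hf : Function.Surjective f) :
    LinearMap.ker (D.inducedMap f) ≤
      Submodule.span Bᵐᵒᵖ (Set.range fun n : LinearMap.ker f => D.inducedMk N 1 n) := by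
  set P := Submodule.span Bᵐᵒᵖ (Set.range fun n : LinearMap.ker f => D.inducedMk N 1 n) with hP
  have hmem : ∀ (b : B) (n : N), f n = 0 → D.inducedMk N b n ∈ P := fun b n hn => by
    rw [← one_mul b, ← smul_inducedMk]
    exact P.smul_mem _ (Submodule.subset_span ⟨⟨n, hn⟩, rfl⟩)
  -- The section need not be `A`-linear; two lifts differ by an element of `ker f`, so `g` is
  -- `A`-linear after passing to the quotient by `P`.
  obtain ⟨σ, hσ⟩ := (f.restrictScalars k).exists_rightInverse_of_surjective
    (LinearMap.range_eq_top.2 hf)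
  have hσ' : ∀ n, f (σ n) = n := fun n => LinearMap.congr_fun hσ n
  set g : N' →ₗ[k] D.Induced N ⧸ P := P.mkQ.restrictScalars k ∘ₗ D.inducedMk N 1 ∘ₗ σ
  have hg : ∀ a n, g (MulOpposite.op a • n) = MulOpposite.op (D.ι a * D.e) • g n := by
    intro a n
    change P.mkQ (D.inducedMk N 1 (σ (MulOpposite.op a • n))) =
      MulOpposite.op (D.ι a * D.e) • P.mkQ (D.inducedMk N 1 (σ n))
    rw [← map_smul, smul_inducedMk, one_mul, ← mul_one (D.ι a * D.e), inducedMk_ι_mul,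
      ← sub_eq_zero, ← map_sub, ← map_sub, Submodule.mkQ_apply, Submodule.Quotient.mk_eq_zero]
    exact hmem _ _ (by rw [map_sub, hσ', map_smul, hσ', sub_self])
  have hcomp : D.inducedHom g hg ∘ₗ D.inducedMap f = P.mkQ := D.induced_hom_ext fun b n => by
    rw [LinearMap.comp_apply, inducedMap_mk, inducedHom_mk]
    change MulOpposite.op b • P.mkQ (D.inducedMk N 1 (σ (f n))) = _
    rw [← map_smul, smul_inducedMk, one_mul, ← sub_eq_zero, ← map_sub, ← map_sub,
      Submodule.mkQ_apply, Submodule.Quotient.mk_eq_zero]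
    exact hmem _ _ (by rw [map_sub, hσ', sub_self])
  intro z hz
  rw [← P.ker_mkQ, LinearMap.mem_ker, ← hcomp, LinearMap.comp_apply, LinearMap.mem_ker.1 hz,
    map_zero]

theorem gkDimModule_ker_inducedMap_le [IsNoetherianRing B] (f : N →ₗ[Aᵐᵒᵖ] N')
    (hf : Function.Surjective f) :
    gkDimModule k B (LinearMap.ker (D.inducedMap f)) ≤ gkDimModule k A (LinearMap.ker f) := by
  refine D.gkDimModule_le_of_span_eq_top (N := LinearMap.ker f)
    ((D.inducedMk N 1 ∘ₗ (LinearMap.ker f).subtype.restrictScalars k).codRestrict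
      ((LinearMap.ker (D.inducedMap f)).restrictScalars k) fun n => ?_) (fun a n => ?_)
      (fun n => ?_) ?_
  · rw [Submodule.restrictScalars_mem, LinearMap.mem_ker]
    change D.inducedMap f (D.inducedMk N 1 n) = 0
    rw [inducedMap_mk, LinearMap.mem_ker.1 n.2, map_zero]
  · exact Subtype.ext (D.inducedMk_one_smul a n.1)
  · exact Subtype.ext (D.e_smul_inducedMk_one n.1)
  · exact Submodule.span_range_eq_top_of_le (k := k) _ (D.ker_inducedMap_le f hf)

theorem gkDimModule_coker_inducedMap_le [IsNoetherianRing B] (f : N →ₗ[Aᵐᵒᵖ] N') :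
    gkDimModule k B (D.Induced N' ⧸ LinearMap.range (D.inducedMap f)) ≤
      gkDimModule k A (N' ⧸ LinearMap.range f) := by
  refine D.gkDimModule_le_of_span_eq_top (N := N' ⧸ LinearMap.range f)
    (((LinearMap.range f).restrictScalars k).liftQ
      ((LinearMap.range (D.inducedMap f)).mkQ.restrictScalars k ∘ₗ D.inducedMk N' 1) ?_)
      (fun a n => ?_) (fun n => ?_) ?_
  · rintro _ ⟨n, rfl⟩
    change (LinearMap.range (D.inducedMap f)).mkQ (D.inducedMk N' 1 (f n)) = 0
    rw [Submodule.mkQ_apply, Submodule.Quotient.mk_eq_zero]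
    exact ⟨D.inducedMk N 1 n, D.inducedMap_mk f 1 n⟩
  · obtain ⟨n, rfl⟩ := (LinearMap.range f).mkQ_surjective n
    exact congrArg (LinearMap.range (D.inducedMap f)).mkQ (D.inducedMk_one_smul a n)
  · obtain ⟨n, rfl⟩ := (LinearMap.range f).mkQ_surjective n
    exact congrArg (LinearMap.range (D.inducedMap f)).mkQ (D.e_smul_inducedMk_one n)
  · rw [eq_top_iff]
    rintro z -
    obtain ⟨z, rfl⟩ := (LinearMap.range (D.inducedMap f)).mkQ_surjective z
    have hz : z ∈ Submodule.span Bᵐᵒᵖ (Set.range (D.inducedMk N' 1)) := by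
      rw [span_range_inducedMk_one]
      exact Submodule.mem_top
    have hz' := Submodule.mem_map_of_mem (f := (LinearMap.range (D.inducedMap f)).mkQ) hz
    rw [Submodule.map_span] at hz'
    refine Submodule.span_mono ?_ hz'
    rintro _ ⟨_, ⟨n, rfl⟩, rfl⟩
    exact ⟨(LinearMap.range f).mkQ n, rfl⟩

/-- Restricting to the corner turns the induced map back into `f`, so an injective `f` leaves
nothing of the kernel after multiplication by `e`. This replaces flatness of `eB`. -/
theorem e_smul_eq_zero_of_inducedMap_eq_zero (f : N →ₗ[Aᵐᵒᵖ] N') (hf : Function.Injective f)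
    {z : D.Induced N} (hz : D.inducedMap f z = 0) : MulOpposite.op D.e • z = 0 := by
  obtain ⟨n, hn⟩ := D.exists_smul_e_eq z
  have h1 : D.inducedMk N' 1 (f n) = 0 := by
    rw [← inducedMap_mk, ← hn, map_smul, hz, smul_zero]
  have h2 : f n = 0 := D.unit_injective (Subtype.ext (by rw [coe_unit, h1, map_zero]; rfl))
  rw [hn, hf (h2.trans (map_zero f).symm), map_zero]

theorem gkDimModule_ker_fixedMap_le (f : M →ₗ[Bᵐᵒᵖ] M') :
    gkDimModule k A (LinearMap.ker (D.fixedMap f)) ≤ gkDimModule k B (LinearMap.ker f) := by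
  refine D.gkDimModule_le_of_injective (M := LinearMap.ker f)
    (((D.fixed M).subtype ∘ₗ
      (LinearMap.ker (D.fixedMap f)).subtype.restrictScalars k).codRestrict
        ((LinearMap.ker f).restrictScalars k) fun m => ?_) (fun a m => rfl) ?_
  · exact congrArg Subtype.val (LinearMap.mem_ker.1 m.2)
  · exact fun m m' h => Subtype.ext (Subtype.ext
      (congrArg (fun z : LinearMap.ker f => (z : M)) h))

/-- The cokernel of the restricted map embeds in that of `f`: if `m = me` equals `f y`, then `m = f
(ye)` already comes from the corner. -/
theorem gkDimModule_coker_fixedMap_le (f : M →ₗ[Bᵐᵒᵖ] M') :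
    gkDimModule k A (D.fixed M' ⧸ LinearMap.range (D.fixedMap f)) ≤
      gkDimModule k B (M' ⧸ LinearMap.range f) := by
  refine D.gkDimModule_le_of_injective (M := M' ⧸ LinearMap.range f)
    (((LinearMap.range (D.fixedMap f)).restrictScalars k).liftQ
      ((LinearMap.range f).mkQ.restrictScalars k ∘ₗ (D.fixed M').subtype) ?_) (fun a m => ?_) ?_
  · rintro _ ⟨m, rfl⟩
    change (LinearMap.range f).mkQ (f m) = 0
    rw [Submodule.mkQ_apply, Submodule.Quotient.mk_eq_zero]
    exact ⟨m, rfl⟩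
  · obtain ⟨m, rfl⟩ := (LinearMap.range (D.fixedMap f)).mkQ_surjective m
    rfl
  · refine (injective_iff_map_eq_zero _).2 fun z hz => ?_
    obtain ⟨m, rfl⟩ := (LinearMap.range (D.fixedMap f)).mkQ_surjective z
    obtain ⟨y, hy⟩ := (Submodule.Quotient.mk_eq_zero (LinearMap.range f)).1 hz
    rw [Submodule.mkQ_apply, Submodule.Quotient.mk_eq_zero]
    refine ⟨⟨MulOpposite.op D.e • y, D.smul_e_mem_fixed y⟩, Subtype.ext ?_⟩
    rw [coe_fixedMap, map_smul, hy]
    exact m.2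

theorem e_smul_eq_zero_of_counit_eq_zero {z : D.Induced (D.fixed M)} (hz : D.counit M z = 0) :
    MulOpposite.op D.e • z = 0 := by
  obtain ⟨n, hn⟩ := D.exists_smul_e_eq z
  have h : (n : M) = 0 := by
    have := D.counit_mk 1 n
    rw [← hn, map_smul, hz] at this
    simpa using this.symm
  have hn0 : n = 0 := Subtype.ext h
  rw [hn, hn0, map_zero]

theorem e_smul_mem_range_counit (m : M) :
    MulOpposite.op D.e • m ∈ LinearMap.range (D.counit M) :=
  ⟨D.inducedMk _ 1 ⟨_, D.smul_e_mem_fixed m⟩, by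
    rw [counit_mk, MulOpposite.op_one, one_smul]⟩

end

/-! ### Descent to the quotient categories. -/

section Graded

variable {k A B : Type u} [Field k] [Ring A] [Algebra k A] [Ring B] [Algebra k B]
variable {D : Corner k A B} {𝒜 : ℕ → Submodule k A} {ℬ : ℕ → Submodule k B}
variable [IsNoetherianRing Bᵐᵒᵖ]

namespace IsGraded

variable (hD : D.IsGraded 𝒜 ℬ) {s : EReal}
include hD

theorem isoModGKDim_fixedFunctor_map {M M' : GrMod ℬ} (f : M ⟶ M') (hf : isoModGKDim ℬ s f) :
    isoModGKDim 𝒜 s (hD.fixedFunctor.map f) :=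
  ⟨(D.gkDimModule_ker_fixedMap_le (lin f)).trans hf.1,
    (D.gkDimModule_coker_fixedMap_le (lin f)).trans hf.2⟩

theorem isoModGKDim_unit (N : GrMod 𝒜) : isoModGKDim 𝒜 s (hD.unitNatTrans.app N) := by
  have h1 : LinearMap.ker (D.unit N.carrier) = ⊥ := LinearMap.ker_eq_bot.2 D.unit_injective
  have h2 : LinearMap.range (D.unit N.carrier) = ⊤ := LinearMap.range_eq_top.2 D.unit_surjective
  have h3 : Subsingleton (LinearMap.ker (D.unit N.carrier)) := by
    rw [h1]; infer_instance
  have h4 : Subsingleton (D.fixed (D.Induced N.carrier) ⧸ LinearMap.range (D.unit N.carrier)) := by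
    rw [h2]; exact Submodule.Quotient.subsingleton_iff.2 rfl
  constructor
  · exact (gkDimModule_of_subsingleton (k := k) (B := A)
      (M := LinearMap.ker (D.unit N.carrier))).trans_le bot_le
  · exact (gkDimModule_of_subsingleton (k := k) (B := A)
      (M := D.fixed (D.Induced N.carrier) ⧸ LinearMap.range (D.unit N.carrier))).trans_le bot_le

variable (hs : ∀ (M : Type u) [AddCommGroup M] [Module k M] [Module Bᵐᵒᵖ M]
  [IsScalarTower k Bᵐᵒᵖ M] [Module.Finite Bᵐᵒᵖ M], (∀ m : M, MulOpposite.op D.e • m = 0) →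
    gkDimModule k B M ≤ s)
include hs

/-- Kernel and cokernel are killed by `e`, and `hs` bounds all finitely generated modules of that
kind. Right noetherianity makes the kernel finitely generated. -/
theorem isoModGKDim_counit (M : GrMod ℬ) : isoModGKDim ℬ s (hD.counitNatTrans.app M) := by
  constructor
  · have : Module.Finite Bᵐᵒᵖ (D.Induced (D.fixed M.carrier)) :=
      (hD.inducedObj (hD.fixedObj M)).finite
    exact hs (LinearMap.ker (D.counit M.carrier)) fun z =>
      Subtype.ext (D.e_smul_eq_zero_of_counit_eq_zero z.2)
  · refine hs (M.carrier ⧸ LinearMap.range (D.counit M.carrier)) fun m => ?_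
    obtain ⟨m, rfl⟩ := (LinearMap.range (D.counit M.carrier)).mkQ_surjective m
    rw [← map_smul, Submodule.mkQ_apply, Submodule.Quotient.mk_eq_zero]
    exact D.e_smul_mem_range_counit m

/-- The morphism is factored through its image: on the surjection the new kernel is controlled by
right exactness, on the injection it is killed by `e`. Concluding in the localization, where
isomorphisms compose, avoids any additivity of GK-dimension on extensions. -/
theorem isIso_map_inducedFunctor_map [IsNoetherianRing B] {N N' : GrMod 𝒜} (f : N ⟶ N')
    (hf : isoModGKDim 𝒜 s f) :
    IsIso ((isoModGKDim ℬ s).Q.map (hD.inducedFunctor.map f)) := by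
  have h1 : isoModGKDim ℬ s (hD.inducedFunctor.map (toImage f)) := by
    have hsurj : Function.Surjective (lin f).rangeRestrict := (lin f).surjective_rangeRestrict
    constructor
    · refine (D.gkDimModule_ker_inducedMap_le (lin f).rangeRestrict hsurj).trans ?_
      rw [LinearMap.ker_rangeRestrict]
      exact hf.1
    · refine (D.gkDimModule_coker_inducedMap_le (lin f).rangeRestrict).trans ?_
      have : Subsingleton (LinearMap.range (lin f) ⧸ LinearMap.range (lin f).rangeRestrict) :=
        Submodule.Quotient.subsingleton_iff.2 (LinearMap.range_eq_top.2 hsurj)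
      exact gkDimModule_of_subsingleton.trans_le bot_le
  have h2 : isoModGKDim ℬ s (hD.inducedFunctor.map (imageIncl f)) := by
    constructor
    · have : Module.Finite Bᵐᵒᵖ (D.Induced (LinearMap.range (lin f))) :=
        (hD.inducedObj (image f)).finite
      exact hs (LinearMap.ker (D.inducedMap (LinearMap.range (lin f)).subtype)) fun z =>
        Subtype.ext (D.e_smul_eq_zero_of_inducedMap_eq_zero _ Subtype.val_injective z.2)
    · refine (D.gkDimModule_coker_inducedMap_le (LinearMap.range (lin f)).subtype).trans ?_
      rw [Submodule.range_subtype]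
      exact hf.2
  have := Localization.inverts (isoModGKDim ℬ s).Q (isoModGKDim ℬ s) _ h1
  have := Localization.inverts (isoModGKDim ℬ s).Q (isoModGKDim ℬ s) _ h2
  rw [← toImage_comp_imageIncl f, Functor.map_comp, Functor.map_comp]
  infer_instance

/-- The quotient categories of a graded algebra and of a corner are equivalent. -/
theorem nonempty_qgr_equivalence [IsNoetherianRing B] : Nonempty (Qgr 𝒜 s ≌ Qgr ℬ s) := by
  let WA := isoModGKDim 𝒜 s
  let WB := isoModGKDim ℬ s
  have hG : WA.IsInvertedBy (hD.inducedFunctor ⋙ WB.Q) := fun N N' f hf =>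
    hD.isIso_map_inducedFunctor_map hs f hf
  have hF : WB.IsInvertedBy (hD.fixedFunctor ⋙ WA.Q) := fun M M' f hf =>
    Localization.inverts WA.Q WA _ (hD.isoModGKDim_fixedFunctor_map f hf)
  let G' := Localization.lift (hD.inducedFunctor ⋙ WB.Q) hG WA.Q
  let F' := Localization.lift (hD.fixedFunctor ⋙ WA.Q) hF WB.Q
  have hη : ∀ N, IsIso (WA.Q.map (hD.unitNatTrans.app N)) := fun N =>
    Localization.inverts WA.Q WA _ (hD.isoModGKDim_unit N)
  have hε : ∀ M, IsIso (WB.Q.map (hD.counitNatTrans.app M)) := fun M =>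
    Localization.inverts WB.Q WB _ (hD.isoModGKDim_counit hs M)
  let η : WA.Q ≅ (hD.inducedFunctor ⋙ hD.fixedFunctor) ⋙ WA.Q :=
    NatIso.ofComponents (fun N => @asIso _ _ _ _ _ (hη N)) fun f => by
      have := congrArg WA.Q.map (hD.unitNatTrans.naturality f)
      rw [Functor.map_comp, Functor.map_comp] at this
      exact this
  let ε : (hD.fixedFunctor ⋙ hD.inducedFunctor) ⋙ WB.Q ≅ WB.Q :=
    NatIso.ofComponents (fun M => @asIso _ _ _ _ _ (hε M)) fun f => by
      have := congrArg WB.Q.map (hD.counitNatTrans.naturality f)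
      rw [Functor.map_comp, Functor.map_comp] at this
      exact this
  let α : (hD.inducedFunctor ⋙ WB.Q) ⋙ F' ≅ WA.Q :=
    Functor.associator _ _ _ ≪≫
      Functor.isoWhiskerLeft hD.inducedFunctor (Localization.fac _ hF WB.Q) ≪≫ η.symm
  let β : (hD.fixedFunctor ⋙ WA.Q) ⋙ G' ≅ WB.Q :=
    Functor.associator _ _ _ ≪≫
      Functor.isoWhiskerLeft hD.fixedFunctor (Localization.fac _ hG WA.Q) ≪≫ ε
  exact ⟨Localization.equivalence WA.Q WA WB.Q WB (hD.inducedFunctor ⋙ WB.Q) G'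
    (hD.fixedFunctor ⋙ WA.Q) F' α β⟩

end IsGraded

end Graded

end Corner

/-! ## The antipode of a Hopf algebra with a normalized integral -/

section Antipode

variable {k H : Type*} [Field k] [Ring H] [HopfAlgebra k H]

theorem sum_counit_right_smul {ι : Type*} {h : H} (rep : Coalgebra.Repr k h ι) :
    ∑ i ∈ rep.index, Coalgebra.counit (R := k) (rep.right i) • rep.left i = h := by
  simpa only [map_sum, TensorProduct.rid_tmul, one_smul] using
    congrArg (TensorProduct.rid k H) (Coalgebra.sum_tmul_counit_eq rep)

/-- By coassociativity the sum is `∑ h₁ ⊗ h₂ S(h₃)`, and the antipode axiom collapses the last two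
factors. -/
theorem sum_comul_mul_one_tmul_antipode {ι : Type*} {h : H} (rep : Coalgebra.Repr k h ι) :
    ∑ i ∈ rep.index, Coalgebra.comul (R := k) (rep.left i) *
      ((1 : H) ⊗ₜ[k] HopfAlgebra.antipode k (rep.right i)) = h ⊗ₜ[k] (1 : H) := by
  let rl := fun i => Coalgebra.Repr.arbitrary k (rep.left i)
  let rr := fun i => Coalgebra.Repr.arbitrary k (rep.right i)
  have key := congrArg (TensorProduct.map LinearMap.id
    (LinearMap.mul' k H ∘ₗ (HopfAlgebra.antipode k).lTensor H) :
      H ⊗[k] (H ⊗[k] H) →ₗ[k] H ⊗[k] H) (Coalgebra.sum_tmul_tmul_eq rep rl rr)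
  simp only [map_sum, TensorProduct.map_tmul, LinearMap.id_apply, LinearMap.comp_apply,
    LinearMap.lTensor_tmul, LinearMap.mul'_apply] at key
  calc _ = ∑ i ∈ rep.index, ∑ j ∈ (rl i).index, (rl i).left j ⊗ₜ[k]
        ((rl i).right j * HopfAlgebra.antipode k (rep.right i)) := by
        refine Finset.sum_congr rfl fun i _ => ?_
        rw [← (rl i).eq, Finset.sum_mul]
        simp only [Algebra.TensorProduct.tmul_mul_tmul, mul_one]
    _ = ∑ i ∈ rep.index, rep.left i ⊗ₜ[k] (Coalgebra.counit (R := k) (rep.right i) • (1 : H)) := by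
        rw [key]
        refine Finset.sum_congr rfl fun i _ => ?_
        rw [← TensorProduct.tmul_sum, HopfAlgebra.sum_mul_antipode_eq_smul]
    _ = (∑ i ∈ rep.index, Coalgebra.counit (R := k) (rep.right i) • rep.left i) ⊗ₜ[k] 1 := by
        rw [TensorProduct.sum_tmul]
        exact Finset.sum_congr rfl fun i _ => (TensorProduct.smul_tmul _ _ _).symm
    _ = h ⊗ₜ[k] 1 := by
        rw [sum_counit_right_smul rep]

/-- Substituting the previous identity for `h ⊗ 1` gives `∑ Δ(t h₁)(1 ⊗ S(h₂))`, and `t h₁ = ε(h₁)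
t`. -/
theorem IsNormalizedIntegral.comul_mul_tmul_one {t : H} (ht : IsNormalizedIntegral k t) (h : H) :
    Coalgebra.comul (R := k) t * (h ⊗ₜ[k] 1) =
      Coalgebra.comul (R := k) t * (1 ⊗ₜ[k] HopfAlgebra.antipode k h) := by
  let rep := Coalgebra.Repr.arbitrary k h
  rw [← sum_comul_mul_one_tmul_antipode rep, Finset.mul_sum]
  simp only [← mul_assoc, ← Bialgebra.comul_mul, ht.right, map_smul, smul_mul_assoc,
    ← mul_smul_comm, ← TensorProduct.tmul_smul]
  rw [← Finset.mul_sum, ← TensorProduct.tmul_sum]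
  simp only [← map_smul]
  rw [← map_sum, Coalgebra.sum_counit_smul]

/-- Write `Δ(t) = ∑ c_i ⊗ b_i` with `b_i` a basis. If `S(h) = 0`, then `Δ(t)(xh ⊗ 1) = Δ(t)(1 ⊗
S(h)S(x)) = 0`, so `c_i x h = 0` for all `x` and `i`. Taking `x = S(b_i)` and summing gives `h =
ε(t) h = 0`. -/
theorem IsNormalizedIntegral.antipode_injective [Module.Finite k H] {t : H}
    (ht : IsNormalizedIntegral k t) : Function.Injective (HopfAlgebra.antipode k : H →ₗ[k] H) := by
  refine (injective_iff_map_eq_zero _).2 fun h hh => ?_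
  obtain ⟨c, hc⟩ := TensorProduct.eq_repr_basis_right (Module.finBasis k H)
    (Coalgebra.comul (R := k) t)
  have hzero : ∀ x : H, ∀ i, c i * (x * h) = 0 := by
    intro x
    have h1 := ht.comul_mul_tmul_one (x * h)
    rw [HopfAlgebra.antipode_mul_antidistrib, hh, zero_mul, TensorProduct.tmul_zero, mul_zero,
      ← hc, Finsupp.sum, Finset.sum_mul] at h1
    simp only [Algebra.TensorProduct.tmul_mul_tmul, mul_one] at h1
    intro i
    have h2 := TensorProduct.sum_tmul_basis_right_eq_zero (Module.finBasis k H)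
      (c.mapRange (· * (x * h)) (zero_mul _)) (by
        rw [Finsupp.sum_mapRange_index (by simp)]
        exact h1)
    simpa using DFunLike.congr_fun h2 i
  have h3 := HopfAlgebra.mul_antipode_lTensor_comul_apply (R := k) t
  rw [ht.counit_eq_one, map_one, ← hc, Finsupp.sum, map_sum, map_sum] at h3
  rw [← one_mul h, ← h3, Finset.sum_mul]
  refine Finset.sum_eq_zero fun i _ => ?_
  rw [LinearMap.lTensor_tmul, LinearMap.mul'_apply, mul_assoc, hzero]

/-- Applying the injective antihomomorphism `S` turns the left side into `∑ h₁ S(h₂)`. -/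
theorem sum_mul_antipode_inv {σ : H →ₗ[k] H} (hσ : ∀ h, HopfAlgebra.antipode k (σ h) = h)
    (hS : Function.Injective (HopfAlgebra.antipode k : H →ₗ[k] H))
    {ι : Type*} {h : H} (rep : Coalgebra.Repr k h ι) :
    ∑ i ∈ rep.index, rep.right i * σ (rep.left i) = Coalgebra.counit (R := k) h • 1 := by
  apply hS
  rw [map_sum]
  simp only [HopfAlgebra.antipode_mul_antidistrib, hσ]
  rw [HopfAlgebra.sum_mul_antipode_eq_smul, map_smul, HopfAlgebra.antipode_one]

end Antipode

/-! ## The smash product as a noetherian ring -/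

/-- The hypothesis says that `B` is generated by `s` as a left `R`-module. Stating it through
additive submonoids avoids fixing an `R`-module structure on `B`, so that it also serves for
opposite rings. -/
theorem isNoetherianRing_of_ringHom {R B : Type*} [Ring R] [Ring B] [IsNoetherianRing R]
    (f : R →+* B) (s : Finset B) (hs : ∀ P : AddSubmonoid B,
      (∀ r, ∀ x ∈ s, f r * x ∈ P) → ∀ b, b ∈ P) : IsNoetherianRing B := by
  let _ : Module R B := Module.compHom B f
  have : IsScalarTower R B B := ⟨fun r x y => mul_assoc (f r) x y⟩
  have : Module.Finite R B := ⟨s, eq_top_iff.2 fun b _ =>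
    hs (Submodule.span R (s : Set B)).toAddSubmonoid
      (fun r x hx => Submodule.smul_mem _ r (Submodule.subset_span hx)) b⟩
  exact isNoetherian_of_tower R inferInstance

namespace SmashProduct

variable {k R H : Type*} [Field k] [Ring R] [Algebra k R]

section

variable [Ring H] [Algebra k H]

theorem mk_add_left (r s : R) (h : H) : mk k (r + s) h = mk k r h + mk k s h :=
  TensorProduct.add_tmul r s h

theorem mk_add_right (r : R) (g h : H) : mk k r (g + h) = mk k r g + mk k r h :=
  TensorProduct.tmul_add r g h

theorem mk_smul_left (c : k) (r : R) (h : H) : mk k (c • r) h = c • mk k r h :=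
  (TensorProduct.smul_tmul' c r h).symm

theorem mk_smul_right (c : k) (r : R) (h : H) : mk k r (c • h) = c • mk k r h :=
  TensorProduct.tmul_smul c r h

theorem mk_zero_left (h : H) : mk k (0 : R) h = 0 := TensorProduct.zero_tmul _ h

theorem mk_zero_right (r : R) : mk k r (0 : H) = 0 := TensorProduct.tmul_zero _ r

variable {𝒜 : ℕ → Submodule k R}

theorem mk_mem_grading {n : ℕ} {r : R} (hr : r ∈ 𝒜 n) (h : H) :
    mk k r h ∈ grading k H 𝒜 n := ⟨(⟨r, hr⟩ : 𝒜 n) ⊗ₜ h, rfl⟩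

theorem grading_le {n : ℕ} {P : Submodule k (SmashProduct k R H)}
    (h : ∀ r ∈ 𝒜 n, ∀ h, mk k r h ∈ P) : grading k H 𝒜 n ≤ P := by
  let f : 𝒜 n ⊗[k] H →ₗ[k] SmashProduct k R H := (𝒜 n).subtype.rTensor H
  rintro _ ⟨z, rfl⟩
  change f z ∈ P
  induction z with
  | zero => rw [map_zero]; exact zero_mem _
  | add x y hx hy => rw [map_add]; exact add_mem hx hy
  | tmul r g => exact h r.1 r.2 g

theorem isInternal_grading (h𝒜 : DirectSum.IsInternal 𝒜) :
    DirectSum.IsInternal (grading k H 𝒜) := by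
  let m : R →ₗ[k] H →ₗ[k] SmashProduct k R H := TensorProduct.mk k R H
  let δ : SmashProduct k R H →ₗ[k] (ℕ →₀ SmashProduct k R H) :=
    TensorProduct.lift ((Finsupp.lsum k fun i => m.compr₂ (Finsupp.lsingle i)) ∘ₗ h𝒜.coaction)
  refine DirectSum.isInternal_of_coaction _ LinearMap.id Function.injective_id δ
    (fun i x hx => ?_) ?_
  · refine (grading_le (P := LinearMap.eqLocus δ (Finsupp.lsingle i)) fun r hr h => ?_) hx
    change (Finsupp.lsum k fun i => m.compr₂ (Finsupp.lsingle i)) (h𝒜.coaction r) h =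
      Finsupp.single i (mk k r h)
    rw [h𝒜.coaction_of_mem hr]
    simp only [Finsupp.lsum_single]
    rfl
  · rw [eq_top_iff]
    rintro z -
    induction z using ind with
    | h0 => exact zero_mem _
    | hadd x y hx hy => exact add_mem hx hy
    | hmk r h =>
      have hr : r ∈ ⨆ i, 𝒜 i := h𝒜.submodule_iSup_eq_top ▸ Submodule.mem_top
      induction hr using Submodule.iSup_induction' with
      | zero => rw [mk_zero_left]; exact zero_mem _
      | add x y _ _ hx hy => rw [mk_add_left]; exact add_mem hx hy
      | mem i r hr => exact Submodule.mem_iSup_of_mem i (mk_mem_grading hr h)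


end

variable [Ring H] [HopfAlgebra k H]

/-- The map `r # h ↦ ε(h) r`. -/
def counitRight (k R H : Type*) [Field k] [Ring R] [Algebra k R] [Ring H] [HopfAlgebra k H] :
    SmashProduct k R H →ₗ[k] R :=
  (TensorProduct.rid k R).toLinearMap ∘ₗ (Coalgebra.counit : H →ₗ[k] k).lTensor R

theorem counitRight_mk (r : R) (h : H) :
    counitRight k R H (mk k r h) = Coalgebra.counit (R := k) h • r := rfl

variable [Module H R] [IsScalarTower k H R]

theorem mk_one_mul_mk (r s : R) (g : H) : mk k r (1 : H) * mk k s g = mk k (r * s) g := by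
  let rep : Coalgebra.Repr k (1 : H) Unit :=
    { index := {()}, left := fun _ => 1, right := fun _ => 1,
      eq := by simp [Algebra.TensorProduct.one_def] }
  rw [mk_mul_mk rep]
  simp [rep]

variable [IsHModuleAlgebra k R H]

theorem mk_mul_mk_one (r : R) (h g : H) : mk k r h * mk k 1 g = mk k r (h * g) := by
  let rep := Coalgebra.Repr.arbitrary k h
  have h1 : ∀ x : H, x • (1 : R) = Coalgebra.counit (R := k) x • (1 : R) := fun x => by
    rw [IsHModuleAlgebra.smul_one (k := k), Algebra.algebraMap_eq_smul_one]
  rw [mk_mul_mk rep]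
  simp only [h1, mul_smul_comm, mul_one, mk_smul_left]
  simp only [← mk_smul_right, ← smul_mul_assoc]
  rw [← mk_sum_right, ← Finset.sum_mul, Coalgebra.sum_counit_smul]

theorem one_mk_mul_mk_of_mem {a : R} (ha : a ∈ hopfInvariants k R H) (h : H) :
    mk k 1 h * mk k a 1 = mk k a h := by
  let rep := Coalgebra.Repr.arbitrary k h
  have ha' : ∀ h : H, h • a = Coalgebra.counit (R := k) h • a := ha
  rw [mk_mul_mk rep]
  simp only [ha', one_mul, mul_one, mk_smul_left]
  simp only [← mk_smul_right]
  rw [← mk_sum_right, Coalgebra.sum_counit_smul]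

/-- The inclusion of `R` in the smash product. -/
def inl (k R H : Type*) [Field k] [Ring R] [Algebra k R] [Ring H] [HopfAlgebra k H] [Module H R]
    [IsScalarTower k H R] [IsHModuleAlgebra k R H] : R →ₐ[k] SmashProduct k R H :=
  AlgHom.ofLinearMap
    { toFun := fun r => mk k r 1
      map_add' := fun r s => mk_add_left r s 1
      map_smul' := fun c r => mk_smul_left c r 1 }
    rfl fun r s => (mk_one_mul_mk r s 1).symm

theorem isNoetherianRing [Module.Finite k H] [IsNoetherianRing R] :
    IsNoetherianRing (SmashProduct k R H) := by
  classical
  obtain ⟨s, hs⟩ := Module.finite_def.1 ‹Module.Finite k H›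
  refine isNoetherianRing_of_ringHom (inl k R H).toRingHom (s.image (mk k (1 : R)))
    fun P hP b => ?_
  induction b using ind with
  | h0 => exact zero_mem _
  | hadd x y hx hy => exact add_mem hx hy
  | hmk r h =>
    have hh : h ∈ Submodule.span k (s : Set H) := hs ▸ Submodule.mem_top
    induction hh using Submodule.span_induction generalizing r with
    | mem h hh =>
      have := hP r _ (Finset.mem_image_of_mem (mk k (1 : R)) hh)
      change mk k r 1 * mk k 1 h ∈ P at this
      rwa [mk_one_mul_mk, mul_one] at this
    | zero => rw [mk_zero_right]; exact zero_mem _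
    | add x y _ _ hx hy => rw [mk_add_right]; exact add_mem (hx r) (hy r)
    | smul c x _ hx => rw [mk_smul_right, ← mk_smul_left]; exact hx (c • r)

/-- With `σ = S⁻¹` this is `r # h = ∑ (1 # h₂)(S⁻¹(h₁) r # 1)`: expanding the product produces `h₂
S⁻¹(h₁)`, which collapses to a counit. It lets elements of `R` be moved to the right of `H`. -/
theorem sum_one_mk_mul_mk {σ : H →ₗ[k] H} (hσ : ∀ h, HopfAlgebra.antipode k (σ h) = h)
    (hS : Function.Injective (HopfAlgebra.antipode k : H →ₗ[k] H))
    {ι : Type*} {h : H} (rep : Coalgebra.Repr k h ι) (r : R) :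
    ∑ i ∈ rep.index, mk k 1 (rep.right i) * mk k (σ (rep.left i) • r) 1 = mk k r h := by
  let rl := fun i => Coalgebra.Repr.arbitrary k (rep.left i)
  let rr := fun i => Coalgebra.Repr.arbitrary k (rep.right i)
  have key := congrArg (((hopfAct k R H).flip r ∘ₗ LinearMap.mul' k H ∘ₗ
    (TensorProduct.comm k H H).toLinearMap ∘ₗ σ.rTensor H).rTensor H ∘ₗ
    (TensorProduct.assoc k H H H).symm.toLinearMap) (Coalgebra.sum_tmul_tmul_eq rep rl rr)
  simp only [map_sum] at key
  have key' : ∑ i ∈ rep.index, ∑ j ∈ (rl i).index,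
      mk k (((rl i).right j * σ ((rl i).left j)) • r) (rep.right i) =
      ∑ i ∈ rep.index, ∑ j ∈ (rr i).index,
        mk k (((rr i).left j * σ (rep.left i)) • r) ((rr i).right j) := key
  have hL : ∀ i, mk k 1 (rep.right i) * mk k (σ (rep.left i) • r) 1 =
      ∑ j ∈ (rr i).index, mk k (((rr i).left j * σ (rep.left i)) • r) ((rr i).right j) := fun i => by
    rw [mk_mul_mk (rr i)]
    simp only [one_mul, mul_one, mul_smul]
  simp only [hL]
  rw [← key']
  simp only [← mk_sum_left, ← Finset.sum_smul, sum_mul_antipode_inv hσ hS]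
  simp only [smul_assoc, one_smul, mk_smul_left]
  simp only [← mk_smul_right]
  rw [← mk_sum_right, Coalgebra.sum_counit_smul]

/-- Injectivity of the antipode on the finite-dimensional `H` makes it bijective, so `B = H·R` is a
finitely generated right `R`-module. -/
theorem isNoetherianRing_op [Module.Finite k H] [IsNoetherianRing Rᵐᵒᵖ] {t : H}
    (ht : IsNormalizedIntegral k t) : IsNoetherianRing (SmashProduct k R H)ᵐᵒᵖ := by
  classical
  have hS := ht.antipode_injective
  let σ := (LinearEquiv.ofInjectiveEndo _ hS).symm.toLinearMap
  have hσ : ∀ h, HopfAlgebra.antipode k (σ h) = h :=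
    (LinearEquiv.ofInjectiveEndo _ hS).apply_symm_apply
  obtain ⟨s, hs⟩ := Module.finite_def.1 ‹Module.Finite k H›
  refine isNoetherianRing_of_ringHom (inl k R H).toRingHom.op
    (s.image fun h => MulOpposite.op (mk k (1 : R) h)) fun P hP b => ?_
  have hmem : ∀ (h : H) (r : R), MulOpposite.op (mk k 1 h * mk k r 1) ∈ P := fun h r => by
    have hh : h ∈ Submodule.span k (s : Set H) := hs ▸ Submodule.mem_top
    induction hh using Submodule.span_induction generalizing r with
    | mem h hh =>
      exact hP (MulOpposite.op r) _
        (Finset.mem_image_of_mem (fun h => MulOpposite.op (mk k (1 : R) h)) hh)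
    | zero => rw [mk_zero_right, zero_mul]; exact zero_mem _
    | add x y _ _ hx hy => rw [mk_add_right, add_mul]; exact add_mem (hx r) (hy r)
    | smul c x _ hx =>
      rw [mk_smul_right, smul_mul_assoc, ← mul_smul_comm, ← mk_smul_left]
      exact hx (c • r)
  obtain ⟨b, rfl⟩ := MulOpposite.op_surjective b
  induction b using ind with
  | h0 => exact zero_mem _
  | hadd x y hx hy => exact add_mem hx hy
  | hmk r h =>
    rw [← sum_one_mk_mul_mk hσ hS (Coalgebra.Repr.arbitrary k h) r, Finset.op_sum]
    exact sum_mem fun i _ => hmem _ _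

/-! ## The invariants as a corner of the smash product -/

theorem smul_mem_hopfInvariants {t : H} (ht : IsNormalizedIntegral k t) (r : R) :
    t • r ∈ hopfInvariants k R H := fun h => by
  rw [← mul_smul, ht.left, smul_assoc]

/-- The projection `r ↦ t • r` to the invariants. -/
def traceMap {t : H} (ht : IsNormalizedIntegral k t) : R →ₗ[k] hopfInvariants k R H :=
  (hopfAct k R H t).codRestrict (Subalgebra.toSubmodule (hopfInvariants k R H))
    (smul_mem_hopfInvariants ht)

theorem coe_traceMap {t : H} (ht : IsNormalizedIntegral k t) (r : R) :
    (traceMap ht r : R) = t • r := rfl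

theorem traceMap_coe {t : H} (ht : IsNormalizedIntegral k t) (a : hopfInvariants k R H) :
    traceMap ht (a : R) = a := Subtype.ext (by
  rw [coe_traceMap]
  have : t • (a : R) = (Coalgebra.counit (R := k) t) • (a : R) := a.2 t
  rw [this, ht.counit_eq_one, one_smul])

/-- The invariant ring as the corner of the smash product attached to a normalized integral. -/
def corner {t : H} (ht : IsNormalizedIntegral k t) :
    Corner k (hopfInvariants k R H) (SmashProduct k R H) where
  ι := (inl k R H).comp (hopfInvariants k R H).val
  e := mk k 1 t
  θ := traceMap ht ∘ₗ counitRight k R H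
  idem := by rw [mk_mul_mk_one, ht.left, ht.counit_eq_one, one_smul]
  comm a := by
    change mk k (a : R) 1 * mk k 1 t = mk k 1 t * mk k (a : R) 1
    rw [mk_mul_mk_one, one_mul, one_mk_mul_mk_of_mem a.2]
  compress b := by
    induction b using ind with
    | h0 => rw [mul_zero, zero_mul, map_zero, map_zero, zero_mul]
    | hadd x y hx hy => rw [mul_add, add_mul, hx, hy, map_add, map_add, add_mul]
    | hmk r h =>
      change mk k 1 t * mk k r h * mk k 1 t =
        mk k (traceMap ht (counitRight k R H (mk k r h)) : R) 1 * mk k 1 t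
      -- The value is `ε(h) (t • r) # t`: the right-hand `t` absorbs `h`, and then each `t₂` from
      -- `Δ(t)`, into counits.
      let rep := Coalgebra.Repr.arbitrary k t
      rw [mul_assoc, mk_mul_mk_one, ht.left, mk_smul_right, mul_smul_comm, mk_mul_mk rep,
        mk_mul_mk_one, one_mul, counitRight_mk, coe_traceMap, smul_comm, mk_smul_left]
      congr 1
      simp only [one_mul, ht.left, mk_smul_right]
      simp only [← mk_smul_left, ← smul_assoc]
      rw [← mk_sum_left, ← Finset.sum_smul, sum_counit_right_smul]
  inj a h := by
    change mk k (a : R) 1 * mk k 1 t = 0 at h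
    rw [mk_mul_mk_one, one_mul] at h
    -- Applying `r # h ↦ ε(h) r` recovers `a` from `a # t` because `ε(t) = 1`.
    have := congrArg (counitRight k R H) h
    rw [counitRight_mk, ht.counit_eq_one, one_smul, map_zero] at this
    exact Subtype.ext this

section Grading

variable {𝒜 : ℕ → Submodule k R}

theorem isGraded_corner [GradedAlgebra 𝒜]
    (hact : ∀ (n : ℕ) (h : H) (r : R), r ∈ 𝒜 n → h • r ∈ 𝒜 n) {t : H}
    (ht : IsNormalizedIntegral k t) :
    (corner (R := R) ht).IsGraded (hopfInvariantsGrading H 𝒜) (grading k H 𝒜) where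
  e_mem := mk_mem_grading (SetLike.GradedOne.one_mem (A := 𝒜)) t
  ι_mem {i a} ha := mk_mem_grading (H := H) (show (a : R) ∈ 𝒜 i from ha) 1
  iSup_eq_top := Submodule.iSup_eq_top_of_surjective (traceMap ht)
    (fun a => ⟨a, traceMap_coe ht a⟩) (fun i r hr => hact i t r hr)
    (DirectSum.Decomposition.isInternal 𝒜).submodule_iSup_eq_top
  isInternal := isInternal_grading (DirectSum.Decomposition.isInternal 𝒜)
  mul_mem {i j b c} hb hc := by
    refine (grading_le (P := (grading k H 𝒜 (i + j)).comap (LinearMap.mulRight k c))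
      fun r hr h => ?_) hb
    refine (grading_le (P := (grading k H 𝒜 (i + j)).comap (LinearMap.mulLeft k (mk k r h)))
      fun s hs g => ?_) hc
    change mk k r h * mk k s g ∈ grading k H 𝒜 (i + j)
    rw [mk_mul_mk (Coalgebra.Repr.arbitrary k h)]
    exact sum_mem fun l _ => mk_mem_grading
      (SetLike.GradedMul.mul_mem hr (hact j _ s hs)) _

end Grading

end SmashProduct

end

theorem theorem0p6 {k R H : Type u} [Field k] [Ring R] [Algebra k R]
    [Ring H] [HopfAlgebra k H] [Module.Finite k H]
    [Module H R] [IsScalarTower k H R] [IsHModuleAlgebra k R H]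
    (𝒜 : ℕ → Submodule k R) [GradedAlgebra 𝒜]
    (hright : IsNoetherianRing Rᵐᵒᵖ) (hleft : IsNoetherianRing R)
    (hfin : ∀ n : ℕ, Module.Finite k (𝒜 n))
    (hact : ∀ (n : ℕ) (h : H) (r : R), r ∈ 𝒜 n → h • r ∈ 𝒜 n)
    (t : H) (ht : IsNormalizedIntegral k t)
    (d : ℝ) (hd : gkDim k R = (d : EReal))
    (α : ℤ) (hα : ((α : ℝ) : EReal) ≤ pertinency k R t) :
    Nonempty (Qgr (hopfInvariantsGrading H 𝒜) ((d - α : ℝ) : EReal) ≌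
      Qgr (SmashProduct.grading k H 𝒜) ((d - α : ℝ) : EReal)) := by
  have hB : IsNoetherianRing (SmashProduct k R H) := SmashProduct.isNoetherianRing
  have hB' : IsNoetherianRing (SmashProduct k R H)ᵐᵒᵖ := SmashProduct.isNoetherianRing_op ht
  have hquot : gkDim k (SmashQuotient k R t) ≤ ((d - α : ℝ) : EReal) := by
    rw [pertinency, hd] at hα
    induction hx : gkDim k (SmashQuotient k R t) with
    | bot => exact bot_le
    -- An infinite GK-dimension of the quotient would make the pertinency `⊥`, which no integer is
    -- below.
    | top => rw [hx] at hα; simp at hα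
    | coe x =>
      rw [hx, ← EReal.coe_sub, EReal.coe_le_coe_iff] at hα
      rw [EReal.coe_le_coe_iff]
      linarith
  refine (SmashProduct.isGraded_corner hact ht).nonempty_qgr_equivalence ?_
  intro M _ _ _ _ _ hM
  let I := TwoSidedIdeal.span {SmashProduct.mk k (1 : R) t}
  let π : SmashProduct k R H →ₐ[k] SmashQuotient k R t :=
    { I.ringCon.mk' with commutes' := fun _ => rfl }
  refine (gkDimModule_le_gkDim_of_quotient π (RingCon.mk'_surjective _) fun b hb m => ?_).trans
    hquot
  refine smul_eq_zero_of_mem_twoSidedIdeal_span hM ?_ m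
  rw [TwoSidedIdeal.mem_iff]
  exact (RingCon.eq _).1 hb
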